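/- **Theorem (Time complexity of the TTF algorithm).** Let $G=(V,E)$ be a simple, connected, undirected graph with $n=|V|\ge 2$ nodes, $m=|E|$ edges and diameter $\Delta$, given by adjacency arrays; let $r\in V$, let $P=D^{-1}A$ be the transition matrix of the simple random walk on $G$, and let $P_r$ be $P$ with the row and the column of $r$ removed. The algorithm TTF with root $r$ and $\omega$ samples first computes a breadth-first search tree $\tau_0$ rooted at $r$, its depth-first numbering and the number $2m$, and initializes an array `vol_sum` to zero (preprocessing). Then it repeats $\omega$ times: (i) sample a spanning tree $\tau$ rooted at $r$ by Wilson's algorithm (loop-erased random walks, started at the nodes in a fixed order and stopped when they hit the current tree, which initially is $\{r\}$); (ii) compute $\mathrm{vol}[v]$, the sum of the degrees in $G$ over the subtree $\mathrm{Sub}(\tau,v)$, for all $v$; (iii) run a depth-first search on $\tau$ that, on entering a node $v\ne r$ with parent $p(v)$ in $\tau$, adds $2m-\mathrm{vol}[v]$ to `vol_sum` on $\mathrm{Sub}(\tau_0,v)$ if $p(v)$ is the parent of $v$ in $\tau_0$, subtracts $2m-\mathrm{vol}[v]$ on $\mathrm{Sub}(\tau_0,p(v))$ if $v$ is the parent of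 $p(v)$ in $\tau_0$, then adds $d(v)\cdot$`vol_sum`$[v]$ to the estimate $\tilde\kappa$, recurses to the children of $v$ in $\tau$, and undoes the update. Finally it returns $\tilde\kappa/(2m\omega)$. The array `vol_sum` is kept either in a binary indexed tree (BIT) over the depth-first numbers of $\tau_0$, or naively, by storing each update at the root of the updated subtree and answering a query at $v$ by traversing the path from $v$ to $r$ in $\tau_0$; TTF chooses the naive variant if the height of $\tau_0$ is at most $\log_2 n$, and the BIT otherwise. Running time is counted in the unit-cost random access model, in which drawing a uniformly random neighbour takes one unit of time. There is an absolute constant $C$ such that, for all such $G$, $r$ and all $\omega\ge 0$: 1. $I-P_r$ is invertible, the expected total number of random-walk steps in one run of Wilson's algorithm is exactly $\mathrm{Tr}(I-P_r)^{-1}$, and its expected running time is at most $C\,\mathrm{Tr}(I-P_r)^{-1}$. 2. For every spanning tree $\tau$ of $G$ rooted at $r$, steps (ii) and (iii) take time at most $C\,n\log n$ with the BIT and at most $C\,n\Delta$ with the naive traversal. 3. The preprocessing takes time at most $C\,m$. 4. The expected running time of the sampling loop is at most $C\,\omega\left(\mathrm{Tr}(I-P_r)^{-1}+n\min(\Delta,\log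 n)\right)$, and that of the whole algorithm is at most $C\left(m+\omega\left(\mathrm{Tr}(I-P_r)^{-1}+n\min(\Delta,\log n)\right)\right)$. -/

import Mathlib

open scoped ENNReal

namespace KemenyTTF

/-! ### Cost model

The running time is measured in the unit-cost random access model: reading or writing one array
cell, one integer operation or comparison, and drawing one uniformly random neighbour of a vertex
each take constant time. Every `tick` below stands for a bounded number of such operations.
Arrays are modelled as functions; they are only accessed cell by cell, and creating an array
is charged its length. -/

/-- A deterministic computation: its result together with the number of elementary operations. -/
structure Timed (α : Type) where
  val : α
  time : ℕ

instance : Monad Timed where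
  pure a := ⟨a, 0⟩
  bind c f := ⟨(f c.val).val, c.time + (f c.val).time⟩

/-- Spend `k` elementary operations. -/
def tick (k : ℕ := 1) : Timed Unit := ⟨(), k⟩

/-- The prices of an elementary deterministic operation and of one random draw. -/
structure CostModel where
  basic : ℕ
  draw : ℕ

/-- Running time: everything costs one unit. -/
def timeCost : CostModel := ⟨1, 1⟩

/-- Only random-walk steps are counted. -/
def walkCost : CostModel := ⟨0, 1⟩

/-- A randomized computation, given by what happens when it is run with a cost limit `t`:
the outcome is `some (a, t')` if it returns `a` with `t'` units of the limit left over, and `none`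
if it needs more than `t` units (in particular if it never stops). -/
def Prog (α : Type) : Type := ℕ → PMF (Option (α × ℕ))

noncomputable instance : Monad Prog where
  pure a := fun t => PMF.pure (some (a, t))
  bind p f := fun t => (p t).bind fun
    | none => PMF.pure none
    | some (a, t') => f a t'

/-- The expected cost `E[T] = ∑_{t ≥ 0} Pr[T > t]`; it is infinite whenever the computation fails
to stop with positive probability. -/
noncomputable def expectedCost {α : Type} (p : Prog α) : ℝ≥0∞ := ∑' t : ℕ, p t none

/-- A deterministic computation as part of a randomized one. -/
noncomputable def runTimed {α : Type} (w : CostModel) (c : Timed α) : Prog α := fun t =>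
  if w.basic * c.time ≤ t then PMF.pure (some (c.val, t - w.basic * c.time)) else PMF.pure none

/-! ### Input -/

/-- The input format: the neighbours of every vertex, stored in an array whose length (the degree)
is available in constant time. -/
structure AdjLists {n : ℕ} (G : SimpleGraph (Fin n)) where
  nbrs : Fin n → List (Fin n)
  nodup : ∀ v, (nbrs v).Nodup
  mem_nbrs : ∀ v w, w ∈ nbrs v ↔ G.Adj v w

/-- The degree `d(v)`. -/
def AdjLists.deg {n : ℕ} {G : SimpleGraph (Fin n)} (A : AdjLists G) (v : Fin n) : ℤ :=
  ((A.nbrs v).length : ℤ)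

/-- A rooted tree is stored as its array of parents; the root has parent `none`. -/
abbrev Parents (n : ℕ) : Type := Fin n → Option (Fin n)

/-- `par` is a spanning tree of `G` with all edges directed towards the root `r`. -/
def IsSpanningTree {n : ℕ} (G : SimpleGraph (Fin n)) (r : Fin n) (par : Parents n) : Prop :=
  par r = none ∧ (∀ v, v ≠ r → ∃ p, par v = some p ∧ G.Adj v p) ∧
    ∀ v, ∃ k : ℕ, (fun o : Option (Fin n) => o.bind par)^[k] (some v) = some r

/-- The transition matrix `P = D⁻¹ A` of the simple random walk. -/
noncomputable def transitionMatrix {n : ℕ} (G : SimpleGraph (Fin n)) [DecidableRel G.Adj] :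
    Matrix (Fin n) (Fin n) ℝ :=
  (Matrix.diagonal fun v => (G.degree v : ℝ))⁻¹ * G.adjMatrix ℝ

/-- `I - P_r`, where `P_r` is `P` with the row and the column of `r` removed. -/
noncomputable def laplacianMinor {n : ℕ} (G : SimpleGraph (Fin n)) [DecidableRel G.Adj]
    (r : Fin n) : Matrix {v : Fin n // v ≠ r} {v : Fin n // v ≠ r} ℝ :=
  1 - (transitionMatrix G).submatrix Subtype.val Subtype.val

/-! ### Wilson's algorithm

In the recursions below a first argument of type `ℕ` that is started at `n` bounds the length of a
path followed in a tree on `n` vertices (or the depth of a recursion along such a path); paths in a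
tree have at most `n` vertices, so the bound is never what stops the recursion. -/

/-- Draw a uniformly random neighbour of `u`. (The second case, of an isolated vertex, does not
occur in a connected graph with at least two vertices.) -/
noncomputable def randomNeighbor {n : ℕ} {G : SimpleGraph (Fin n)} (w : CostModel)
    (A : AdjLists G) (u : Fin n) : Prog (Fin n) := fun t =>
  if w.draw ≤ t then
    if h : (A.nbrs u).toFinset.Nonempty then
      (PMF.uniformOfFinset (A.nbrs u).toFinset h).map fun x => some (x, t - w.draw)
    else PMF.pure (some (u, t - w.draw))
  else PMF.pure none

/-- `while u ∉ tree do { next[u] ← random neighbour of u; u ← next[u] }`, with at most `f - 1` rounds. -/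
noncomputable def walkRounds {n : ℕ} {G : SimpleGraph (Fin n)} (w : CostModel) (A : AdjLists G)
    (inTree : Fin n → Bool) : ℕ → Fin n → Parents n → Prog (Parents n)
  | 0, _, _ => fun _ => PMF.pure none
  | f + 1, u, next => do
      runTimed w (tick)
      if inTree u then
        return next
      else
        let x ← randomNeighbor w A u
        walkRounds w A inTree f x (Function.update next u (some x))

/-- The loop `while u ∉ tree do { next[u] ← random neighbour of u; u ← next[u] }`. Every round costs
at least one unit (as long as a random draw does), so that with cost limit `t` at most `t` rounds
can be completed, and allowing for `t + 1` of them is no restriction. -/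
noncomputable def walk {n : ℕ} {G : SimpleGraph (Fin n)} (w : CostModel) (A : AdjLists G)
    (inTree : Fin n → Bool) (u : Fin n) (next : Parents n) : Prog (Parents n) := fun t =>
  walkRounds w A inTree (t + 2) u next t

/-- `while u ∉ tree do { add u to the tree; u ← next[u] }`: add the loop-erased walk. -/
def addPath {n : ℕ} (next : Parents n) : ℕ → Fin n → (Fin n → Bool) → Timed (Fin n → Bool)
  | 0, _, inTree => pure inTree
  | f + 1, u, inTree => do
      tick
      if inTree u then
        return inTree
      else
        match next u with
        | none => return inTree
        | some x => addPath next f x (Function.update inTree u true)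

/-- Wilson's algorithm: starting from the tree `{r}`, for one vertex after the other a random walk
is run until it hits the current tree, and its loop erasure (which is what the last exits
`next` record) is added to the tree. -/
noncomputable def wilson {n : ℕ} {G : SimpleGraph (Fin n)} (w : CostModel) (A : AdjLists G)
    (r : Fin n) : Prog (Parents n) := do
  runTimed w (tick (2 * n))
  let s ← (List.finRange n).foldlM
    (fun (s : (Fin n → Bool) × Parents n) v => do
      let next ← walk w A s.1 v s.2
      let inTree ← runTimed w (addPath next n v s.1)
      return (inTree, next))
    (Function.update (fun _ => false) r true, fun _ => none)
  return s.2

/-! ### Breadth-first search, children, depth-first numbers, subtree volumes -/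

/-- State of the breadth-first search; `fresh` collects the vertices of the next level. -/
structure BFSState (n : ℕ) where
  visited : Fin n → Bool
  par : Parents n
  fresh : List (Fin n)

/-- Scan the neighbours of `v`; the ones not seen before become children of `v`. -/
def bfsScan {n : ℕ} {G : SimpleGraph (Fin n)} (A : AdjLists G) (s : BFSState n) (v : Fin n) :
    Timed (BFSState n) := do
  tick
  (A.nbrs v).foldlM (fun (s : BFSState n) x => do
    tick
    if s.visited x then
      return s
    else
      return ⟨Function.update s.visited x true, Function.update s.par x (some v), x :: s.fresh⟩) s

/-- Process level after level, starting from the level `s.fresh`, until a level is empty (there are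
at most `n` nonempty levels); `h` counts the levels. Returns the tree and its height. -/
def bfsLevels {n : ℕ} {G : SimpleGraph (Fin n)} (A : AdjLists G) :
    ℕ → ℕ → BFSState n → Timed (Parents n × ℕ)
  | 0, h, s => pure (s.par, h)
  | f + 1, h, s => do
      tick
      let s' ← s.fresh.foldlM (bfsScan A) { s with fresh := [] }
      if s'.fresh.isEmpty then
        return (s'.par, h)
      else
        bfsLevels A f (h + 1) s'

/-- The breadth-first search tree with root `r`, and its height. -/
def bfs {n : ℕ} {G : SimpleGraph (Fin n)} (A : AdjLists G) (r : Fin n) :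
    Timed (Parents n × ℕ) := do
  tick (2 * n)
  bfsLevels A n 0 ⟨Function.update (fun _ => false) r true, fun _ => none, [r]⟩

/-- The lists of children in a tree. -/
def childLists {n : ℕ} (par : Parents n) : Timed (Fin n → List (Fin n)) := do
  tick n
  (List.finRange n).foldlM (fun (ch : Fin n → List (Fin n)) v => do
    tick
    match par v with
    | none => return ch
    | some p => return Function.update ch p (v :: ch p)) fun _ => []

/-- Depth-first numbering: current clock, entry numbers and exit numbers. The vertices are numbered
from `1`, and the subtree of `v` consists of the vertices numbered `dfsIn v, …, dfsOut v`. -/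
structure DFN (n : ℕ) where
  clock : ℕ
  dfsIn : Fin n → ℕ
  dfsOut : Fin n → ℕ

/-- Number the subtree of `v`. -/
def dfnFrom {n : ℕ} (ch : Fin n → List (Fin n)) : ℕ → Fin n → DFN n → Timed (DFN n)
  | 0, _, s => pure s
  | f + 1, v, s => do
      tick
      let s' ← (ch v).foldlM (fun s c => dfnFrom ch f c s)
        ⟨s.clock + 1, Function.update s.dfsIn v (s.clock + 1), s.dfsOut⟩
      tick
      return { s' with dfsOut := Function.update s'.dfsOut v s'.clock }

/-- Fill in `vol[u] = ∑_{x ∈ Sub(τ, u)} d(x)` for all `u` in the subtree of `v`. -/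
def volumesFrom {n : ℕ} {G : SimpleGraph (Fin n)} (A : AdjLists G) (ch : Fin n → List (Fin n)) :
    ℕ → Fin n → (Fin n → ℤ) → Timed (Fin n → ℤ)
  | 0, _, vol => pure vol
  | f + 1, v, vol => do
      tick
      (ch v).foldlM (fun (vol : Fin n → ℤ) c => do
        let vol' ← volumesFrom A ch f c vol
        tick
        return Function.update vol' v (vol' v + vol' c)) (Function.update vol v (A.deg v))

/-! ### The structure `vol_sum` -/

/-- The lowest set bit of `i`. -/
def lowbit (i : ℕ) : ℕ := i - (i &&& (i - 1))

theorem and_pred_lt {i : ℕ} (h : 0 < i) : i &&& (i - 1) < i :=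
  lt_of_le_of_lt Nat.and_le_right (Nat.sub_lt h Nat.one_pos)

theorem lowbit_pos {i : ℕ} (h : 0 < i) : 0 < lowbit i :=
  Nat.sub_pos_of_lt (and_pred_lt h)

/-- Binary indexed tree with cells `1, …, n`: add `x` to all prefix sums of length at least `i`. -/
def bitAdd (n i : ℕ) (x : ℤ) (a : ℕ → ℤ) : Timed (ℕ → ℤ) :=
  if h : 0 < i ∧ i ≤ n then do
    tick
    bitAdd n (i + lowbit i) x (Function.update a i (a i + x))
  else do
    tick
    return a
termination_by n + 1 - i
decreasing_by
  have := lowbit_pos h.1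
  omega

/-- Binary indexed tree: the prefix sum of length `i`. -/
def bitSum (a : ℕ → ℤ) (i : ℕ) : Timed ℤ :=
  if h : 0 < i then do
    tick
    let s ← bitSum a (i &&& (i - 1))
    return a i + s
  else do
    tick
    return 0
termination_by i
decreasing_by exact and_pred_lt h

/-- The sum of the cells of all vertices on the path from `v` to the root of `par`. -/
def pathSum {n : ℕ} (par : Parents n) (a : ℕ → ℤ) : ℕ → Fin n → Timed ℤ
  | 0, _ => pure 0
  | f + 1, v => do
      tick
      match par v with
      | none => return a v
      | some p => do
          let s ← pathSum par a f p
          return a v + s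

/-- The two implementations of `vol_sum`: a binary indexed tree over the depth-first numbers of
`τ₀` (logarithmic update and query), or naively one cell per vertex and, for a query at `v`, a
traversal of the path from `v` to the root in `τ₀` (constant update, query linear in the path). -/
inductive Mode where
  | bit
  | path

/-- Everything that is computed before sampling starts: the breadth-first search tree `τ₀`, its
depth-first numbers, the number `2m`, the implementation of `vol_sum`, and the initial `vol_sum`. -/
structure Prep (n : ℕ) where
  par₀ : Parents n
  dfn : DFN n
  twoM : ℤ
  mode : Mode
  store : ℕ → ℤ

/-- Add `x` to `vol_sum[u]` for all `u` in the subtree of `v` in `τ₀`. -/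
def volSumAdd {n : ℕ} (D : Prep n) (mode : Mode) (v : Fin n) (x : ℤ) (a : ℕ → ℤ) :
    Timed (ℕ → ℤ) :=
  match mode with
  | .bit => do
      let a' ← bitAdd n (D.dfn.dfsIn v) x a
      bitAdd n (D.dfn.dfsOut v + 1) (-x) a'
  | .path => do
      tick
      return Function.update a v (a v + x)

/-- The value of `vol_sum[v]`. -/
def volSumQuery {n : ℕ} (D : Prep n) (mode : Mode) (v : Fin n) (a : ℕ → ℤ) : Timed ℤ :=
  match mode with
  | .bit => bitSum a (D.dfn.dfsIn v)
  | .path => pathSum D.par₀ a n v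

/-! ### The algorithm -/

/-- Preprocessing. The naive implementation of `vol_sum` is chosen if the height of the
breadth-first search tree is at most `log₂ n`. -/
def preprocess {n : ℕ} {G : SimpleGraph (Fin n)} (A : AdjLists G) (r : Fin n) :
    Timed (Prep n) := do
  let b ← bfs A r
  let ch ← childLists b.1
  tick (2 * n)
  let dfn ← dfnFrom ch n r ⟨0, fun _ => 0, fun _ => 0⟩
  let twoM ← (List.finRange n).foldlM (fun (s : ℤ) v => do tick; return s + A.deg v) 0
  tick (Nat.log 2 n + 1)
  let mode := if b.2 ≤ Nat.log 2 n then Mode.path else Mode.bit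
  tick (n + 1)
  return ⟨b.1, dfn, twoM, mode, fun _ => 0⟩

/-- The update of `vol_sum` on entering `v`: if the edge from `v` to its parent `p` in `τ` is also an
edge of `τ₀` directed in the same way, then `2m - vol[v]` is added on the subtree of `v` in `τ₀`; if
the reverse edge belongs to `τ₀`, then `2m - vol[v]` is subtracted on the subtree of `p` in `τ₀`. -/
def shift {n : ℕ} (D : Prep n) (par : Parents n) (vol : Fin n → ℤ) (v : Fin n) :
    Option (Fin n × ℤ) :=
  match par v with
  | none => none
  | some p =>
      if D.par₀ v = some p then some (v, D.twoM - vol v)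
      else if D.par₀ p = some v then some (p, vol v - D.twoM)
      else none

/-- The recursive procedure `DFS(v, τ, τ₀)`; the state consists of the estimator accumulated so far
and of `vol_sum`. -/
def dfs {n : ℕ} {G : SimpleGraph (Fin n)} (A : AdjLists G) (D : Prep n) (mode : Mode)
    (par : Parents n) (ch : Fin n → List (Fin n)) (vol : Fin n → ℤ) :
    ℕ → Fin n → ℤ × (ℕ → ℤ) → Timed (ℤ × (ℕ → ℤ))
  | 0, _, s => pure s
  | f + 1, v, s => do
      tick
      let a ← match shift D par vol v with
        | none => pure s.2
        | some (u, x) => volSumAdd D mode u x s.2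
      let y ← volSumQuery D mode v a
      let s' ← (ch v).foldlM (fun s c => dfs A D mode par ch vol f c s) (s.1 + A.deg v * y, a)
      let a' ← match shift D par vol v with
        | none => pure s'.2
        | some (u, x) => volSumAdd D mode u (-x) s'.2
      return (s'.1, a')

/-- What is done with one sampled tree: subtree volumes and depth-first search. -/
def processSample {n : ℕ} {G : SimpleGraph (Fin n)} (A : AdjLists G) (r : Fin n) (D : Prep n)
    (mode : Mode) (par : Parents n) (s : ℤ × (ℕ → ℤ)) : Timed (ℤ × (ℕ → ℤ)) := do
  let ch ← childLists par
  tick n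
  let vol ← volumesFrom A ch n r fun _ => 0
  dfs A D mode par ch vol n r s

/-- The sampling loop with `k` samples. -/
noncomputable def samplingLoop {n : ℕ} {G : SimpleGraph (Fin n)} (A : AdjLists G) (r : Fin n)
    (D : Prep n) : ℕ → ℤ × (ℕ → ℤ) → Prog (ℤ × (ℕ → ℤ))
  | 0, s => pure s
  | k + 1, s => do
      runTimed timeCost (tick)
      let par ← wilson timeCost A r
      let s' ← runTimed timeCost (processSample A r D D.mode par s)
      samplingLoop A r D k s'

/-- The algorithm TTF with root `r` and `ω` samples. -/
noncomputable def ttf {n : ℕ} {G : SimpleGraph (Fin n)} (A : AdjLists G) (r : Fin n) (ω : ℕ) :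
    Prog ℚ := do
  let D ← runTimed timeCost (preprocess A r)
  let s ← samplingLoop A r D ω (0, D.store)
  runTimed timeCost (tick)
  return (s.1 : ℚ) / ((D.twoM : ℚ) * ω)

end KemenyTTF

namespace KemenyTTF

/-! ### Running times of deterministic computations -/

/-! The heart of the matter is the exact cost of Wilson's algorithm. Let G_B be the Green function
of the walk killed on B (`green`). When the current tree is S, the expected number of steps still to
be made is ∑_{x ∉ S} G_S(x,x) (`greenTrace`), wherever the next walk starts: if γ is the loop
erasure of a walk from v to S, then E[G_{S∪γ}(x,x)] = G_S(x,x) - G_S(v,x), with the left side read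
as 0 for x in γ, and the subtracted terms sum to the expected length of that walk. For S = {r} the
sum is Tr (I - P_r)⁻¹.

This is proved one step at a time, without cycle popping and without sums over paths.
`remainingSteps` extends the claimed value to a walk in progress, as a function of its position and
its loop-erased path. It drops by one per step on average (`remainingSteps_step`, resting on the
symmetry `green_mul_green_insert`), it does not change when a loop is erased
(`remainingSteps_append`), and it has the right values at both ends of the walk
(`remainingSteps_nil`, `remainingSteps_of_mem`). The true expected cost obeys the same recursion,
and a bounded harmonic function on the walk states that vanishes on S is zero
(`eq_zero_of_harmonic`). Finiteness of the expectation has to be known beforehand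
(`expectedCost_walk_bind_ne_top`). The bookkeeping of the algorithm is linear in n and is absorbed
by Tr (I - P_r)⁻¹ ≥ n - 1.

A traversal of a sampled tree meets each vertex at most once (`treeSum_le`), so its time is at most
n times the cost of two updates and one query of `vol_sum`. The binary indexed tree needs O(log n)
for these because an update lengthens the run of trailing zeros of the index and a query removes set
bits; the naive traversal needs the height of τ₀, which is at most the diameter. Comparing this
height with log₂ n yields the minimum of the two bounds (`processSample_mode_time_le`).
Breadth-first search is linear by a conserved potential (`bfsWeight`).

Expected costs are sums of tail probabilities over the cost limit. They add up under composition
(`expectedCost_bind`) once the limit is known not to influence a run that stays below it (`Lawful`).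
-/

@[simp] theorem Timed.pure_val {α : Type} (a : α) : (pure a : Timed α).val = a := rfl

@[simp] theorem Timed.pure_time {α : Type} (a : α) : (pure a : Timed α).time = 0 := rfl

@[simp] theorem Timed.bind_val {α β : Type} (c : Timed α) (f : α → Timed β) :
    (c >>= f).val = (f c.val).val := rfl

@[simp] theorem Timed.bind_time {α β : Type} (c : Timed α) (f : α → Timed β) :
    (c >>= f).time = c.time + (f c.val).time := rfl

@[simp] theorem tick_time (k : ℕ) : (tick k).time = k := rfl

theorem Timed.foldlM_val {σ β : Type} (f : σ → β → Timed σ) (l : List β) (s : σ) :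
    (l.foldlM f s).val = l.foldl (fun s b => (f s b).val) s := by
  induction l generalizing s with
  | nil => rfl
  | cons b l ih => simp [List.foldlM_cons, ih]

theorem Timed.foldlM_time_le {σ β : Type} (f : σ → β → Timed σ) (g : β → ℕ)
    (h : ∀ s b, (f s b).time ≤ g b) (l : List β) (s : σ) :
    (l.foldlM f s).time ≤ (l.map g).sum := by
  induction l generalizing s with
  | nil => simp
  | cons b l ih =>
    simp only [List.foldlM_cons, Timed.bind_time, List.map_cons, List.sum_cons]
    exact add_le_add (h s b) (ih _)

theorem foldl_invariant {σ β : Type} (f : σ → β → σ) (I : σ → Prop) (l : List β) (s : σ)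
    (hs : I s) (h : ∀ s, ∀ b ∈ l, I s → I (f s b)) : I (l.foldl f s) := by
  induction l generalizing s with
  | nil => exact hs
  | cons b l ih =>
    exact ih _ (h s b (by simp) hs) fun s b hb => h s b (by simp [hb])

/-! ### Lists of children -/

theorem childLists_val {n : ℕ} (par : Parents n) (p : Fin n) :
    (childLists par).val p = ((List.finRange n).filter fun v => par v = some p).reverse := by
  have key : ∀ (l : List (Fin n)) (ch : Fin n → List (Fin n)),
      (l.foldlM (fun (ch : Fin n → List (Fin n)) v => do
        tick
        match par v with
        | none => return ch
        | some p => return Function.update ch p (v :: ch p)) ch : Timed _).val p =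
      (l.filter fun v => par v = some p).reverse ++ ch p := by
    intro l
    induction l with
    | nil => intro ch; simp
    | cons v l ih =>
      intro ch
      rw [List.foldlM_cons, Timed.bind_val, ih]
      rcases hv : par v with _ | q
      · simp [hv]
      · by_cases hq : q = p
        · subst hq; simp [hv]
        · simp [hv, hq, Function.update_of_ne (Ne.symm hq)]
  exact (key _ _).trans (by simp)

theorem childLists_nodup {n : ℕ} (par : Parents n) (p : Fin n) :
    ((childLists par).val p).Nodup := by
  rw [childLists_val, List.nodup_reverse]
  exact (List.nodup_finRange n).filter _

theorem mem_childLists {n : ℕ} (par : Parents n) (p c : Fin n) :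
    c ∈ (childLists par).val p ↔ par c = some p := by
  simp [childLists_val]

theorem childLists_time_le {n : ℕ} (par : Parents n) : (childLists par).time ≤ 2 * n := by
  calc (childLists par).time = n + _ := rfl
    _ ≤ n + ((List.finRange n).map fun _ => 1).sum := by
      refine Nat.add_le_add_left (Timed.foldlM_time_le _ (fun _ => 1) (fun s b => ?_) _ _) n
      rcases par b with _ | q <;> simp
    _ = 2 * n := by simp [two_mul]

/-! ### Sums along a depth-first traversal -/

/-- The sum of `g` over the vertices met by a traversal of depth less than `f` that starts at `v`. -/
def treeSum {n : ℕ} (ch : Fin n → List (Fin n)) (g : Fin n → ℕ) : ℕ → Fin n → ℕ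
  | 0, _ => 0
  | f + 1, v => g v + ((ch v).map (treeSum ch g f)).sum

theorem iterate_bind_none {n : ℕ} (par : Parents n) (k : ℕ) :
    (fun o : Option (Fin n) => o.bind par)^[k] none = none := by
  induction k with
  | zero => rfl
  | succ k ih => rw [Function.iterate_succ_apply]; exact ih

/-- Unrolling the recursion groups the visits by depth: `x` is met at depth `k` when its `k`-th
ancestor is `v`. Nothing excludes yet that `x` is met at several depths. -/
theorem treeSum_eq {n : ℕ} {par : Parents n} {ch : Fin n → List (Fin n)}
    (hnd : ∀ v, (ch v).Nodup) (hch : ∀ v c, c ∈ ch v ↔ par c = some v) (g : Fin n → ℕ)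
    (f : ℕ) (v : Fin n) :
    treeSum ch g f v = ∑ k ∈ Finset.range f, ∑ x,
      if (fun o : Option (Fin n) => o.bind par)^[k] (some x) = some v then g x else 0 := by
  induction f generalizing v with
  | zero => simp [treeSum]
  | succ f ih =>
    rw [treeSum, Finset.sum_range_succ', add_comm]
    congr 1
    · rw [← List.sum_toFinset _ (hnd v), Finset.sum_congr rfl fun c _ => ih c, Finset.sum_comm]
      refine Finset.sum_congr rfl fun k _ => ?_
      rw [Finset.sum_comm]
      refine Finset.sum_congr rfl fun x _ => ?_
      rw [Function.iterate_succ_apply']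
      rcases (fun o : Option (Fin n) => o.bind par)^[k] (some x) with _ | c
      · simp
      · simp [hch]
    · simp

/-- As `r` has no parent, a chain of ancestors can pass through `r` only once, so every vertex is
counted at one depth at most. Only `par r = none` is needed, and the depth bound `f` is arbitrary.
-/
theorem treeSum_le {n : ℕ} {par : Parents n} {ch : Fin n → List (Fin n)}
    (hnd : ∀ v, (ch v).Nodup) (hch : ∀ v c, c ∈ ch v ↔ par c = some v) {r : Fin n}
    (hr : par r = none) (g : Fin n → ℕ) (f : ℕ) : treeSum ch g f r ≤ ∑ x, g x := by
  rw [treeSum_eq hnd hch, Finset.sum_comm]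
  refine Finset.sum_le_sum fun x _ => ?_
  have huniq : ∀ k l : ℕ, k < l →
      (fun o : Option (Fin n) => o.bind par)^[k] (some x) = some r →
      (fun o : Option (Fin n) => o.bind par)^[l] (some x) = none := by
    intro k l hkl hk
    obtain ⟨j, rfl⟩ := Nat.exists_eq_add_of_lt hkl
    rw [show k + j + 1 = j + (k + 1) by ring, Function.iterate_add_apply,
      Function.iterate_succ_apply', hk]
    simp only [Option.bind_some, hr]
    exact iterate_bind_none par j
  by_cases h : ∃ k, (fun o : Option (Fin n) => o.bind par)^[k] (some x) = some r
  · obtain ⟨k, hk⟩ := h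
    refine (Finset.sum_le_sum (g := fun l => if l = k then g x else 0) fun l _ => ?_).trans ?_
    · rcases lt_trichotomy l k with hl | hl | hl
      · have : (fun o : Option (Fin n) => o.bind par)^[l] (some x) ≠ some r := fun h => by
          have := huniq l k hl h
          rw [hk] at this
          cases this
        simp [this]
      · rw [if_pos hl]
        split_ifs <;> simp
      · simp [huniq k l hl hk]
    · rw [Finset.sum_ite_eq']
      split_ifs <;> simp
  · push Not at h
    simp [h]

theorem sum_length_children_le {n : ℕ} {par : Parents n} {ch : Fin n → List (Fin n)}
    (hnd : ∀ v, (ch v).Nodup) (hch : ∀ v c, c ∈ ch v ↔ par c = some v) :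
    ∑ v, (ch v).length ≤ n := by
  have h1 : ∀ v, (ch v).length = ∑ c, if par c = some v then 1 else 0 := by
    intro v
    rw [← List.toFinset_card_of_nodup (hnd v), Finset.sum_boole, Nat.cast_id]
    congr 1
    ext c
    simp [hch]
  simp only [h1]
  rw [Finset.sum_comm]
  refine (Finset.sum_le_sum (g := fun _ => 1) fun c _ => ?_).trans (by simp)
  rcases par c with _ | p <;> simp

/-! ### Volumes and depth-first numbers -/

theorem volumesFrom_time_le {n : ℕ} {G : SimpleGraph (Fin n)} (A : AdjLists G)
    (ch : Fin n → List (Fin n)) (f : ℕ) (v : Fin n) (vol : Fin n → ℤ) :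
    (volumesFrom A ch f v vol).time ≤ treeSum ch (fun v => 1 + (ch v).length) f v := by
  induction f generalizing v vol with
  | zero => simp [volumesFrom, treeSum]
  | succ f ih =>
    simp only [volumesFrom, treeSum, Timed.bind_time, tick_time, add_assoc]
    gcongr
    refine (Timed.foldlM_time_le _
      (fun c => treeSum ch (fun v => 1 + (ch v).length) f c + 1) ?_ _ _).trans ?_
    · intro s c
      simp only [Timed.bind_time, tick_time, Timed.pure_time]
      exact Nat.add_le_add_right (ih c s) 1
    · rw [List.sum_map_add, add_comm]
      simp

theorem dfnFrom_time_le {n : ℕ} (ch : Fin n → List (Fin n)) (f : ℕ) (v : Fin n) (s : DFN n) :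
    (dfnFrom ch f v s).time ≤ treeSum ch (fun _ => 2) f v := by
  induction f generalizing v s with
  | zero => simp [dfnFrom, treeSum]
  | succ f ih =>
    simp only [dfnFrom, treeSum, Timed.bind_time, tick_time, Timed.pure_time]
    have := Timed.foldlM_time_le (fun s c => dfnFrom ch f c s) (treeSum ch (fun _ => 2) f)
      (fun s c => ih c s) (ch v)
      ⟨s.clock + 1, Function.update s.dfsIn v (s.clock + 1), s.dfsOut⟩
    omega

/-- Together with `dfnFrom_dfsIn_le` this keeps the entry numbers at most `n`, so that a query of
the binary indexed tree is logarithmic in `n`. -/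
theorem dfnFrom_clock {n : ℕ} (ch : Fin n → List (Fin n)) (f : ℕ) (v : Fin n) (s : DFN n) :
    (dfnFrom ch f v s).val.clock = s.clock + treeSum ch (fun _ => 1) f v := by
  induction f generalizing v s with
  | zero => simp [dfnFrom, treeSum]
  | succ f ih =>
    have key : ∀ (l : List (Fin n)) (s : DFN n),
        (l.foldl (fun s c => (dfnFrom ch f c s).val) s).clock =
          s.clock + (l.map (treeSum ch (fun _ => 1) f)).sum := by
      intro l
      induction l with
      | nil => simp
      | cons c l ihl => intro s; simp [ihl, ih, add_assoc]
    simp only [dfnFrom, treeSum, Timed.bind_val, Timed.pure_val, Timed.foldlM_val, key, add_assoc]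

theorem dfnFrom_dfsIn_le {n : ℕ} (ch : Fin n → List (Fin n)) (f : ℕ) (v : Fin n) (s : DFN n)
    (hs : ∀ x, s.dfsIn x ≤ s.clock) (x : Fin n) :
    (dfnFrom ch f v s).val.dfsIn x ≤ (dfnFrom ch f v s).val.clock := by
  induction f generalizing v s x with
  | zero => exact hs x
  | succ f ih =>
    simp only [dfnFrom, Timed.bind_val, Timed.pure_val, Timed.foldlM_val]
    refine foldl_invariant _ (fun s : DFN n => ∀ x, s.dfsIn x ≤ s.clock) _ _ ?_
      (fun s c _ h x => ih c s h x) x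
    intro y
    by_cases hy : y = v
    · subst hy; simp
    · simp only [Function.update_of_ne hy]
      exact (hs y).trans (Nat.le_succ _)

/-! ### Binary indexed trees -/

/-- The operation `i &&& (i - 1)` clears the lowest set bit of `i`. The even and the odd case make
induction over binary digits possible. -/
theorem and_pred_two_mul (a : ℕ) : (2 * a) &&& (2 * a - 1) = 2 * (a &&& (a - 1)) := by
  rcases a with _ | a
  · simp
  · apply Nat.eq_of_testBit_eq
    intro i
    rw [show 2 * (a + 1) - 1 = 2 * a + 1 by omega]
    rcases i with _ | i
    · simp
    · simp [Nat.testBit_succ, Nat.and_div_two, show (2 * a + 1) / 2 = a by omega]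

theorem and_pred_two_mul_add_one (a : ℕ) : (2 * a + 1) &&& (2 * a + 1 - 1) = 2 * a := by
  apply Nat.eq_of_testBit_eq
  intro i
  rcases i with _ | i
  · simp
  · simp [Nat.testBit_succ, Nat.and_div_two, show (2 * a + 1) / 2 = a by omega]

theorem lowbit_two_mul (a : ℕ) : lowbit (2 * a) = 2 * lowbit a := by
  rw [lowbit, lowbit, and_pred_two_mul, Nat.mul_sub]

theorem lowbit_two_mul_add_one (a : ℕ) : lowbit (2 * a + 1) = 1 := by
  rw [lowbit, and_pred_two_mul_add_one]
  omega

/-- Adding the lowest set bit produces a carry at that position, so the number of trailing zeros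
grows. The induction strips one factor 2. -/
theorem two_pow_succ_dvd_add_lowbit (k i : ℕ) (h : 2 ^ k ∣ i) : 2 ^ (k + 1) ∣ i + lowbit i := by
  induction k generalizing i with
  | zero =>
    rcases Nat.even_or_odd' i with ⟨a, rfl | rfl⟩
    · rw [lowbit_two_mul]; exact ⟨a + lowbit a, by ring⟩
    · rw [lowbit_two_mul_add_one]; exact ⟨a + 1, by ring⟩
  | succ k ih =>
    obtain ⟨b, rfl⟩ := h
    rw [pow_succ' 2 k, mul_assoc, lowbit_two_mul, ← Nat.mul_add, pow_succ' 2 (k + 1)]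
    exact Nat.mul_dvd_mul_left 2 (ih _ (Dvd.intro _ rfl))

/-- After `k` updates the index is a multiple of `2 ^ k`; once `k > log₂ n`, a positive such index
exceeds `n` and the loop ends. Here `j` bounds the updates still possible, and the extra unit is the
final test. -/
theorem bitAdd_time_le_of_dvd (n : ℕ) (x : ℤ) (j k i : ℕ) (hj : Nat.log 2 n < k + j)
    (h : 2 ^ k ∣ i) (a : ℕ → ℤ) : (bitAdd n i x a).time ≤ j + 1 := by
  induction j generalizing k i a with
  | zero =>
    rw [bitAdd]
    split_ifs with hi
    · exfalso
      have h1 := Nat.le_of_dvd hi.1 h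
      have h2 := Nat.lt_pow_of_log_lt (b := 2) (by norm_num) hj
      rw [Nat.add_zero] at h2
      omega
    · simp
  | succ j ih =>
    rw [bitAdd]
    split_ifs with hi
    · simp only [Timed.bind_time, tick_time]
      have := ih (k + 1) (i + lowbit i) (by omega) (two_pow_succ_dvd_add_lowbit k i h)
        (Function.update a i (a i + x))
      omega
    · simp

theorem bitAdd_time_le (n i : ℕ) (x : ℤ) (a : ℕ → ℤ) :
    (bitAdd n i x a).time ≤ Nat.log 2 n + 2 :=
  bitAdd_time_le_of_dvd n x (Nat.log 2 n + 1) 0 i (by omega) (one_dvd _) a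

theorem bitSum_zero_time (a : ℕ → ℤ) : (bitSum a 0).time = 1 := by
  rw [bitSum]; simp

theorem bitSum_time_of_pos (a : ℕ → ℤ) {i : ℕ} (h : 0 < i) :
    (bitSum a i).time = 1 + (bitSum a (i &&& (i - 1))).time := by
  rw [bitSum]; simp [h]

/-- The number of rounds is the number of set bits, which doubling preserves. -/
theorem bitSum_two_mul_time (a : ℕ → ℤ) (i : ℕ) :
    (bitSum a (2 * i)).time = (bitSum a i).time := by
  induction i using Nat.strong_induction_on with
  | _ i ih =>
    rcases Nat.eq_zero_or_pos i with rfl | hi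
    · rfl
    · rw [bitSum_time_of_pos a hi, bitSum_time_of_pos a (by omega), and_pred_two_mul,
        ih _ (and_pred_lt hi)]

/-- Dropping the last binary digit lowers the logarithm by one as long as the index stays positive,
and lowers the time by one if the digit is 1 and not at all if it is 0. -/
theorem bitSum_time_le (a : ℕ → ℤ) (i : ℕ) : (bitSum a i).time ≤ Nat.log 2 i + 2 := by
  induction i using Nat.strong_induction_on with
  | _ i ih =>
    rcases Nat.even_or_odd' i with ⟨b, rfl | rfl⟩
    · rcases Nat.eq_zero_or_pos b with rfl | hb
      · simp [bitSum_zero_time]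
      · rw [bitSum_two_mul_time]
        exact (ih b (by omega)).trans (by gcongr; omega)
    · rw [bitSum_time_of_pos a (by omega), and_pred_two_mul_add_one, bitSum_two_mul_time]
      rcases Nat.eq_zero_or_pos b with rfl | hb
      · simp [bitSum_zero_time]
      · have h1 := ih b (by omega)
        have h2 : Nat.log 2 (2 * b + 1) = Nat.log 2 b + 1 := by
          rw [Nat.log_of_one_lt_of_le (by norm_num) (by omega),
            show (2 * b + 1) / 2 = b by omega]
        omega

/-! ### Processing one sample -/

theorem pathSum_time_le {n : ℕ} (par : Parents n) (a : ℕ → ℤ) (f d : ℕ) (v : Fin n)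
    (h : (fun o : Option (Fin n) => o.bind par)^[d] (some v) = none) :
    (pathSum par a f v).time ≤ d := by
  induction f generalizing d v with
  | zero => simp [pathSum]
  | succ f ih =>
    rcases d with _ | d
    · simp at h
    · rw [Function.iterate_succ_apply] at h
      simp only [pathSum, Timed.bind_time, tick_time]
      rcases hp : par v with _ | p
      · simp
      · simp only [Option.bind_some, hp] at h
        have := ih d p h
        simp only [Timed.bind_time, Timed.pure_time]
        omega

/-- Each visit pays for one tick, an update, its undoing, and one query. -/
theorem dfs_time_le {n : ℕ} {G : SimpleGraph (Fin n)} (A : AdjLists G) (D : Prep n) (mode : Mode)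
    (par : Parents n) (ch : Fin n → List (Fin n)) (vol : Fin n → ℤ) (U : ℕ) (Q : ℕ)
    (hU : ∀ u x a, (volSumAdd D mode u x a).time ≤ U)
    (hQ : ∀ v a, (volSumQuery D mode v a).time ≤ Q) (f : ℕ) (v : Fin n) (s : ℤ × (ℕ → ℤ)) :
    (dfs A D mode par ch vol f v s).time ≤ treeSum ch (fun _ => 1 + 2 * U + Q) f v := by
  induction f generalizing v s with
  | zero => simp [dfs, treeSum]
  | succ f ih =>
    have hF := Timed.foldlM_time_le (fun s c => dfs A D mode par ch vol f c s)
      (treeSum ch (fun _ => 1 + 2 * U + Q) f) (fun s c => ih c s) (ch v)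
    simp only [dfs, treeSum, Timed.bind_time, tick_time]
    generalize shift D par vol v = o
    rcases o with _ | ⟨u, x⟩
    · simp only [Timed.bind_time, Timed.pure_time]
      refine le_trans (Nat.add_le_add_left (Nat.add_le_add_left (Nat.add_le_add (hQ _ _)
        (Nat.add_le_add_right (hF _) _)) _) _) (by omega)
    · simp only [Timed.bind_time, Timed.pure_time]
      refine le_trans (Nat.add_le_add_left (Nat.add_le_add (hU _ _ _) (Nat.add_le_add (hQ _ _)
        (Nat.add_le_add (hF _) (Nat.add_le_add_right (hU _ _ _) _)))) _) (by omega)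

theorem processSample_time_le {n : ℕ} {G : SimpleGraph (Fin n)} (A : AdjLists G) {r : Fin n}
    (D : Prep n) (mode : Mode) {par : Parents n} (hr : par r = none) (U Q : ℕ)
    (hU : ∀ u x a, (volSumAdd D mode u x a).time ≤ U)
    (hQ : ∀ v a, (volSumQuery D mode v a).time ≤ Q) (s : ℤ × (ℕ → ℤ)) :
    (processSample A r D mode par s).time ≤ n * (6 + 2 * U + Q) := by
  simp only [processSample, Timed.bind_time, tick_time]
  have hnd := childLists_nodup par
  have hch := mem_childLists par
  have h1 := childLists_time_le par
  have h2 := (volumesFrom_time_le A (childLists par).val n r fun _ => 0).trans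
    (treeSum_le hnd hch hr _ n)
  rw [Finset.sum_add_distrib] at h2
  have h3 := sum_length_children_le hnd hch
  have h4 := fun vol => (dfs_time_le A D mode par (childLists par).val vol U Q hU hQ n r s).trans
    (treeSum_le hnd hch hr _ n)
  simp only [Finset.sum_const, Finset.card_univ, Fintype.card_fin, smul_eq_mul, mul_one] at h2 h4
  have h5 := h4 (volumesFrom A (childLists par).val n r fun _ => 0).val
  -- The summand `5 * n` consists of `2 * n` for the lists of children, `n` for the array `vol`, and
  -- `2 * n` for the volumes (one unit per vertex and one per child link).
  have : n * (6 + 2 * U + Q) = 5 * n + n * (1 + 2 * U + Q) := by ring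
  omega

/-! ### Breadth-first search -/

section BFS

variable {n : ℕ} {G : SimpleGraph (Fin n)}

/-- The effect of looking at the neighbour `x` of `v` during the breadth-first search. -/
def bfsVisit (v : Fin n) (s : BFSState n) (x : Fin n) : BFSState n :=
  if s.visited x then s
  else ⟨Function.update s.visited x true, Function.update s.par x (some v), x :: s.fresh⟩

theorem bfsScan_val (A : AdjLists G) (s : BFSState n) (v : Fin n) :
    (bfsScan A s v).val = (A.nbrs v).foldl (bfsVisit v) s := by
  simp only [bfsScan, Timed.bind_val, Timed.foldlM_val]
  congr 1
  funext s x
  rw [bfsVisit]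
  split_ifs <;> rfl

theorem bfsScan_time_le (A : AdjLists G) (s : BFSState n) (v : Fin n) :
    (bfsScan A s v).time ≤ 1 + (A.nbrs v).length := by
  simp only [bfsScan, Timed.bind_time, tick_time]
  gcongr
  refine (Timed.foldlM_time_le _ (fun _ => 1) (fun s x => ?_) _ _).trans (by simp)
  simp only [Timed.bind_time, tick_time]
  split_ifs <;> simp

/-- The work that is still to be done for the vertices of the current level and for those which
have not been visited. -/
def bfsWeight (A : AdjLists G) (s : BFSState n) : ℕ :=
  (s.fresh.map fun v => 1 + (A.nbrs v).length).sum +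
    ∑ v, if s.visited v then 0 else 1 + (A.nbrs v).length

/-- A newly found vertex moves from the unvisited part of the weight to the fresh part, with the
same contribution. -/
theorem bfsWeight_bfsVisit (A : AdjLists G) (v : Fin n) (s : BFSState n) (x : Fin n) :
    bfsWeight A (bfsVisit v s x) = bfsWeight A s := by
  rw [bfsVisit]
  split_ifs with h
  · rfl
  · simp only [bfsWeight, List.map_cons, List.sum_cons]
    rw [← Finset.add_sum_erase _ _ (Finset.mem_univ x),
      ← Finset.add_sum_erase (a := x) _ (fun v => if s.visited v then 0 else _) (Finset.mem_univ x)]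
    rw [Finset.sum_congr rfl (g := fun v => if s.visited v then 0 else 1 + (A.nbrs v).length)
      fun y hy => by simp [Function.update_of_ne (Finset.ne_of_mem_erase hy)]]
    simp only [Function.update_self, h]
    simp
    ring

theorem bfsLevels_time_le (A : AdjLists G) (f h : ℕ) (s : BFSState n) :
    (bfsLevels A f h s).time ≤ f + bfsWeight A s := by
  induction f generalizing h s with
  | zero => simp [bfsLevels]
  | succ f ih =>
    -- Apart from visits, which conserve the weight, a round only discards the old level. The weight
    -- therefore falls by exactly the bound for the time of scanning that level.
    have hw : bfsWeight A (s.fresh.foldlM (bfsScan A) { s with fresh := [] }).val +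
        (s.fresh.map fun v => 1 + (A.nbrs v).length).sum = bfsWeight A s := by
      rw [Timed.foldlM_val]
      have := foldl_invariant (fun s v => (bfsScan A s v).val)
        (fun t => bfsWeight A t = bfsWeight A { s with fresh := [] }) s.fresh _ rfl
        fun t v _ ht => by
          rw [bfsScan_val]
          exact foldl_invariant _ (fun t => bfsWeight A t = bfsWeight A { s with fresh := [] }) _ _
            ht fun t x _ ht => (bfsWeight_bfsVisit A v t x).trans ht
      rw [this, add_comm]
      simp [bfsWeight]
    have ht := Timed.foldlM_time_le (bfsScan A) (fun v => 1 + (A.nbrs v).length)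
      (bfsScan_time_le A) s.fresh { s with fresh := [] }
    simp only [bfsLevels, Timed.bind_time, tick_time]
    split_ifs
    · simp only [Timed.pure_time]
      omega
    · have := ih (h + 1) (s.fresh.foldlM (bfsScan A) { s with fresh := [] }).val
      omega

theorem bfs_time_le (A : AdjLists G) (r : Fin n) :
    (bfs A r).time ≤ 4 * n + ∑ v, (A.nbrs v).length := by
  simp only [bfs, Timed.bind_time, tick_time]
  have h := bfsLevels_time_le A n 0
    ⟨Function.update (fun _ => false) r true, fun _ => none, [r]⟩
  have hw : bfsWeight A ⟨Function.update (fun _ => false) r true, fun _ => none, [r]⟩ =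
      ∑ v, (1 + (A.nbrs v).length) := by
    rw [bfsWeight, ← Finset.add_sum_erase _ _ (Finset.mem_univ r),
      ← Finset.add_sum_erase (a := r) _ (fun v => 1 + (A.nbrs v).length) (Finset.mem_univ r)]
    rw [Finset.sum_congr rfl (g := fun v => 1 + (A.nbrs v).length)
      fun y hy => by simp [Function.update_of_ne (Finset.ne_of_mem_erase hy)]]
    simp
  rw [hw, Finset.sum_add_distrib] at h
  simp only [Finset.sum_const, Finset.card_univ, Fintype.card_fin, smul_eq_mul, mul_one] at h
  omega

/-- The invariant of the breadth-first search while the vertices at distance `h` are scanned. -/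
structure BFSInv (G : SimpleGraph (Fin n)) (r : Fin n) (h : ℕ) (s : BFSState n) : Prop where
  dist_le : ∀ v, s.visited v = true → G.dist r v ≤ h + 1
  near : ∀ v, G.dist r v ≤ h → s.visited v = true
  mem_fresh : ∀ v, v ∈ s.fresh ↔ s.visited v = true ∧ G.dist r v = h + 1
  par : ∀ v p, s.par v = some p → G.dist r v = G.dist r p + 1
  par_none : ∀ v, s.visited v = false → s.par v = none

/-- All vertices within distance `h` are visited already, so an unvisited neighbour of a vertex at
distance `h` is at distance exactly `h + 1`. -/
theorem BFSInv.visit (hG : G.Connected) {r : Fin n} {h : ℕ} {s : BFSState n}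
    (hs : BFSInv G r h s) {v x : Fin n} (hv : G.dist r v = h) (hx : G.Adj v x) :
    BFSInv G r h (bfsVisit v s x) := by
  rw [bfsVisit]
  split_ifs with hvis
  · exact hs
  have hle : G.dist r x ≤ h + 1 := by
    have := hG.dist_triangle (u := r) (v := v) (w := x)
    rw [SimpleGraph.dist_eq_one_iff_adj.2 hx] at this
    omega
  have hge : ¬ G.dist r x ≤ h := fun hc => hvis (hs.near x hc)
  refine ⟨fun u hu => ?_, fun u hu => ?_, fun u => ?_, fun u p hp => ?_, fun u hu => ?_⟩
  · by_cases hux : u = x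
    · rw [hux]; exact hle
    · simp only [Function.update_of_ne hux] at hu
      exact hs.dist_le u hu
  · by_cases hux : u = x
    · simp [hux]
    · simp only [Function.update_of_ne hux]
      exact hs.near u hu
  · by_cases hux : u = x
    · subst hux
      simp only [List.mem_cons, true_or, Function.update_self, true_and, true_iff]
      omega
    · simp [hux, hs.mem_fresh]
  · by_cases hux : u = x
    · subst hux
      simp only [Function.update_self, Option.some.injEq] at hp
      subst hp
      omega
    · simp only [Function.update_of_ne hux] at hp
      exact hs.par u p hp
  · by_cases hux : u = x
    · simp [hux] at hu
    · simp only [Function.update_of_ne hux] at hu ⊢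
      exact hs.par_none u hu

theorem BFSInv.scan (hG : G.Connected) (A : AdjLists G) {r : Fin n} {h : ℕ} {s : BFSState n}
    (hs : BFSInv G r h s) {v : Fin n} (hv : G.dist r v = h) :
    BFSInv G r h (bfsScan A s v).val := by
  rw [bfsScan_val]
  exact foldl_invariant _ (BFSInv G r h) _ _ hs fun s x hx hs =>
    hs.visit hG hv ((A.mem_nbrs v x).1 hx)

theorem bfsVisit_visited (v : Fin n) (s : BFSState n) (x y : Fin n) (hy : s.visited y = true) :
    (bfsVisit v s x).visited y = true := by
  rw [bfsVisit]
  split_ifs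
  · exact hy
  · by_cases hyx : y = x
    · simp [hyx]
    · simpa [Function.update_of_ne hyx] using hy

theorem bfsVisit_visited_self (v : Fin n) (s : BFSState n) (x : Fin n) :
    (bfsVisit v s x).visited x = true := by
  rw [bfsVisit]
  split_ifs with h
  · exact h
  · simp

theorem foldl_bfsVisit_visited (v : Fin n) (l : List (Fin n)) (s : BFSState n) (y : Fin n)
    (hy : s.visited y = true ∨ y ∈ l) : (l.foldl (bfsVisit v) s).visited y = true := by
  induction l generalizing s with
  | nil => simpa using hy
  | cons x l ih =>
    refine ih _ ?_
    rcases hy with hy | hy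
    · exact Or.inl (bfsVisit_visited v s x y hy)
    · rcases List.mem_cons.1 hy with rfl | hy
      · exact Or.inl (bfsVisit_visited_self v s y)
      · exact Or.inr hy

theorem foldl_bfsScan_visited (A : AdjLists G) (l : List (Fin n)) (s : BFSState n) (y : Fin n)
    (hy : s.visited y = true ∨ ∃ v ∈ l, G.Adj v y) :
    (l.foldl (fun s v => (bfsScan A s v).val) s).visited y = true := by
  induction l generalizing s with
  | nil => simpa using hy
  | cons v l ih =>
    refine ih _ ?_
    beta_reduce
    rw [bfsScan_val]
    rcases hy with hy | ⟨w, hw, hwy⟩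
    · exact Or.inl (foldl_bfsVisit_visited v _ s y (Or.inl hy))
    · rcases List.mem_cons.1 hw with rfl | hw
      · exact Or.inl (foldl_bfsVisit_visited w _ s y (Or.inr ((A.mem_nbrs w y).2 hwy)))
      · exact Or.inr ⟨w, hw, hwy⟩

theorem exists_adj_dist_eq (hG : G.Connected) {r x : Fin n} {h : ℕ} (hx : G.dist r x = h + 1) :
    ∃ v, G.Adj v x ∧ G.dist r v = h := by
  obtain ⟨p, hp⟩ := hG.exists_walk_length_eq_dist x r
  rw [SimpleGraph.dist_comm, hx] at hp
  cases p with
  | nil => simp at hp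
  | @cons _ v _ hxv q =>
    refine ⟨v, hxv.symm, le_antisymm ?_ ?_⟩
    · rw [SimpleGraph.dist_comm]
      simp only [SimpleGraph.Walk.length_cons, Nat.add_right_cancel_iff] at hp
      exact hp ▸ SimpleGraph.dist_le q
    · have := hG.dist_triangle (u := r) (v := v) (w := x)
      rw [SimpleGraph.dist_eq_one_iff_adj.2 hxv.symm] at this
      omega

theorem iterate_parent_eq_none {r : Fin n} {par : Parents n} {h : ℕ}
    (hpar : ∀ v p, par v = some p → G.dist r v = G.dist r p + 1) (v : Fin n)
    (hv : G.dist r v ≤ h) : (fun o : Option (Fin n) => o.bind par)^[h + 1] (some v) = none := by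
  induction h generalizing v with
  | zero =>
    rcases hp : par v with _ | p
    · simp [hp]
    · have := hpar v p hp
      omega
  | succ h ih =>
    rw [Function.iterate_succ_apply]
    rcases hp : par v with _ | p
    · simp only [Option.bind_some, hp]
      exact iterate_bind_none par _
    · simp only [Option.bind_some, hp]
      have := hpar v p hp
      exact ih p (by omega)

/-- Between levels, the visited set is the ball and `fresh` the sphere of radius `h`. The sphere is
nonempty, so the returned height is a distance from `r`, hence at most the diameter. The conclusion
holds for every `f`, also if `f` cuts the search short, because unvisited vertices have no parent.
-/
theorem bfsLevels_spec (hG : G.Connected) (A : AdjLists G) {r : Fin n} (f h : ℕ)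
    (s : BFSState n) (hvis : ∀ v, s.visited v = true ↔ G.dist r v ≤ h)
    (hfresh : ∀ v, v ∈ s.fresh ↔ G.dist r v = h)
    (hne : s.fresh ≠ []) (hpar : ∀ v p, s.par v = some p → G.dist r v = G.dist r p + 1)
    (hnone : ∀ v, s.visited v = false → s.par v = none) :
    (bfsLevels A f h s).val.1 r = none ∧
      (∃ v, G.dist r v = (bfsLevels A f h s).val.2) ∧
      ∀ v, (fun o : Option (Fin n) => o.bind (bfsLevels A f h s).val.1)^[
        (bfsLevels A f h s).val.2 + 1] (some v) = none := by
  have hroot : ∀ par : Parents n, (∀ v p, par v = some p → G.dist r v = G.dist r p + 1) →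
      par r = none := by
    intro par hpar
    rcases hp : par r with _ | p
    · rfl
    · have := hpar r p hp
      simp at this
  have hdepth : ∀ (h : ℕ) (t : BFSState n), (∀ v, t.visited v = true → G.dist r v ≤ h) →
      (∀ v p, t.par v = some p → G.dist r v = G.dist r p + 1) →
      (∀ v, t.visited v = false → t.par v = none) → ∀ v,
      (fun o : Option (Fin n) => o.bind t.par)^[h + 1] (some v) = none := by
    intro h t h1 h2 h3 v
    by_cases hv : t.visited v = true
    · exact iterate_parent_eq_none h2 v (h1 v hv)
    · rw [Function.iterate_succ_apply]
      simp only [Option.bind_some, h3 v (by simpa using hv)]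
      exact iterate_bind_none _ _
  obtain ⟨v₀, hv₀⟩ := List.exists_mem_of_ne_nil _ hne
  induction f generalizing h s v₀ with
  | zero =>
    simp only [bfsLevels, Timed.pure_val]
    exact ⟨hroot _ hpar, ⟨v₀, (hfresh v₀).1 hv₀⟩, hdepth h s (fun v => (hvis v).1) hpar hnone⟩
  | succ f ih =>
    have hinv : BFSInv G r h (s.fresh.foldlM (bfsScan A) { s with fresh := [] }).val := by
      rw [Timed.foldlM_val]
      refine foldl_invariant _ (BFSInv G r h) _ _ ?_ fun t v hv ht =>
        ht.scan hG A ((hfresh v).1 hv)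
      refine ⟨fun v hv => ((hvis v).1 hv).trans (Nat.le_succ _), fun v => (hvis v).2,
        fun v => ?_, hpar, hnone⟩
      simp only [List.not_mem_nil, false_iff, not_and]
      intro hv
      have := (hvis v).1 hv
      omega
    have hall : ∀ v, G.dist r v ≤ h + 1 →
        (s.fresh.foldlM (bfsScan A) { s with fresh := [] }).val.visited v = true := by
      intro v hv
      rw [Timed.foldlM_val]
      refine foldl_bfsScan_visited A _ _ v ?_
      rcases Nat.lt_or_ge h (G.dist r v) with hlt | hle
      · obtain ⟨w, hw, hwd⟩ := exists_adj_dist_eq hG (le_antisymm hv hlt)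
        exact Or.inr ⟨w, (hfresh w).2 hwd, hw⟩
      · exact Or.inl ((hvis v).2 hle)
    simp only [bfsLevels, Timed.bind_val]
    generalize (s.fresh.foldlM (bfsScan A) { s with fresh := [] }).val = t at hinv hall ⊢
    split_ifs with he
    · rw [List.isEmpty_iff] at he
      refine ⟨hroot _ hinv.par, ⟨v₀, (hfresh v₀).1 hv₀⟩, hdepth h t (fun v hv => ?_) hinv.par
        hinv.par_none⟩
      have h1 := hinv.dist_le v hv
      have h2 : ¬ G.dist r v = h + 1 := fun h2 => by
        have := (hinv.mem_fresh v).2 ⟨hv, h2⟩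
        simp [he] at this
      omega
    · have he' : t.fresh ≠ [] := fun hc => he (by simp [hc])
      obtain ⟨v₁, hv₁⟩ := List.exists_mem_of_ne_nil _ he'
      refine ih (h + 1) t (fun v => ⟨hinv.dist_le v, hall v⟩) (fun v => ?_) he' hinv.par
        hinv.par_none v₁ hv₁
      rw [hinv.mem_fresh]
      exact ⟨fun hv => hv.2, fun hv => ⟨hall v hv.le, hv⟩⟩

theorem bfs_spec (hG : G.Connected) (A : AdjLists G) (r : Fin n) :
    (bfs A r).val.1 r = none ∧ (bfs A r).val.2 ≤ G.diam ∧
      ∀ v, (fun o : Option (Fin n) => o.bind (bfs A r).val.1)^[(bfs A r).val.2 + 1] (some v) =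
        none := by
  have : Nonempty (Fin n) := ⟨r⟩
  have hd : ∀ v, G.dist r v = 0 ↔ v = r := fun v => by
    rw [hG.dist_eq_zero_iff, eq_comm]
  obtain ⟨h1, ⟨v, hv⟩, h3⟩ := bfsLevels_spec hG A (r := r) n 0
    ⟨Function.update (fun _ => false) r true, fun _ => none, [r]⟩
    (fun v => by
      rw [Nat.le_zero, hd]
      by_cases hv : v = r
      · simp [hv]
      · simp [hv])
    (fun v => by rw [hd]; simp) (by simp) (by simp) (by simp)
  exact ⟨h1, hv ▸ SimpleGraph.dist_le_diam (SimpleGraph.connected_iff_ediam_ne_top.1 hG), h3⟩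

end BFS

/-! ### Preprocessing and the choice of the data structure -/

section Preprocessing

variable {n : ℕ} {G : SimpleGraph (Fin n)}

theorem AdjLists.toFinset_nbrs [DecidableRel G.Adj] (A : AdjLists G) (v : Fin n) :
    (A.nbrs v).toFinset = G.neighborFinset v := by
  ext w
  simp [A.mem_nbrs]

theorem AdjLists.length_nbrs [DecidableRel G.Adj] (A : AdjLists G) (v : Fin n) :
    (A.nbrs v).length = G.degree v := by
  rw [← List.toFinset_card_of_nodup (A.nodup v), A.toFinset_nbrs, SimpleGraph.card_neighborFinset_eq_degree]

theorem card_le_two_mul_card_edges [DecidableRel G.Adj] (hn : 2 ≤ n) (hG : G.Connected) :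
    n ≤ 2 * G.edgeFinset.card := by
  have h := hG.card_vert_le_card_edgeSet_add_one
  rw [Nat.card_eq_fintype_card, Nat.card_eq_fintype_card, Fintype.card_fin,
    ← SimpleGraph.edgeFinset_card] at h
  omega

theorem preprocess_mode (A : AdjLists G) (r : Fin n) :
    (preprocess A r).val.mode =
      if (bfs A r).val.2 ≤ Nat.log 2 n then Mode.path else Mode.bit := rfl

theorem preprocess_dfn (A : AdjLists G) (r : Fin n) :
    (preprocess A r).val.dfn = (dfnFrom (childLists (bfs A r).val.1).val n r
      ⟨0, fun _ => 0, fun _ => 0⟩).val := rfl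

theorem preprocess_time_le [DecidableRel G.Adj] (hn : 2 ≤ n) (hG : G.Connected) (A : AdjLists G)
    (r : Fin n) : (preprocess A r).time ≤ 30 * G.edgeFinset.card := by
  have h1 := bfs_time_le A r
  have h2 := childLists_time_le (bfs A r).val.1
  have h3 := (dfnFrom_time_le (childLists (bfs A r).val.1).val n r
    ⟨0, fun _ => 0, fun _ => 0⟩).trans (treeSum_le (childLists_nodup _) (mem_childLists _)
      (bfs_spec hG A r).1 _ n)
  have h4 := Timed.foldlM_time_le (fun (s : ℤ) v => do tick; return s + A.deg v) (fun _ => 1)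
    (fun s v => by simp) (List.finRange n) 0
  have h5 : Nat.log 2 n ≤ n := Nat.log_le_self 2 n
  have h6 := card_le_two_mul_card_edges hn hG
  simp only [A.length_nbrs, SimpleGraph.sum_degrees_eq_twice_card_edges] at h1
  simp only [Finset.sum_const, Finset.card_univ, Fintype.card_fin, smul_eq_mul] at h3
  simp only [List.map_const', List.sum_replicate, List.length_finRange, smul_eq_mul,
    mul_one] at h4
  -- The items add up to at most `13 * n + 2 * m + 2`; now `n ≤ 2 * m` and `m ≥ 1` give `30 * m`.
  simp only [preprocess, Timed.bind_time, Timed.pure_time, tick_time]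
  omega

theorem preprocess_dfsIn_le (hG : G.Connected) (A : AdjLists G) (r v : Fin n) :
    (preprocess A r).val.dfn.dfsIn v ≤ n := by
  rw [preprocess_dfn]
  refine (dfnFrom_dfsIn_le _ _ _ _ (fun _ => le_rfl) v).trans ?_
  rw [dfnFrom_clock, zero_add]
  refine (treeSum_le (childLists_nodup _) (mem_childLists _) (bfs_spec hG A r).1 _ n).trans ?_
  simp

theorem processSample_bit_time_le (hG : G.Connected) (A : AdjLists G) {r : Fin n}
    {τ : Parents n} (hτ : τ r = none) (s : ℤ × (ℕ → ℤ)) :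
    (processSample A r (preprocess A r).val .bit τ s).time ≤ n * (16 + 5 * Nat.log 2 n) := by
  -- A range update touches the index tree at both ends of an interval, a query once: with `L =
  -- Nat.log 2 n` this is `6 + 4 * (L + 2) + (L + 2) = 16 + 5 * L`.
  refine (processSample_time_le A (preprocess A r).val .bit hτ (2 * (Nat.log 2 n + 2))
    (Nat.log 2 n + 2) (fun u x a => ?_) (fun v a => ?_) s).trans (le_of_eq (by ring))
  · simp only [volSumAdd, Timed.bind_time]
    have h1 := bitAdd_time_le n ((preprocess A r).val.dfn.dfsIn u) x a
    have h2 := fun a' => bitAdd_time_le n ((preprocess A r).val.dfn.dfsOut u + 1) (-x) a'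
    exact (Nat.add_le_add h1 (h2 _)).trans (by omega)
  · refine (bitSum_time_le a _).trans ?_
    gcongr
    exact preprocess_dfsIn_le hG A r v

theorem processSample_path_time_le (hG : G.Connected) (A : AdjLists G) {r : Fin n}
    {τ : Parents n} (hτ : τ r = none) (s : ℤ × (ℕ → ℤ)) :
    (processSample A r (preprocess A r).val .path τ s).time ≤ n * (9 + (bfs A r).val.2) := by
  refine (processSample_time_le A (preprocess A r).val .path hτ 1
    ((bfs A r).val.2 + 1) (fun u x a => ?_) (fun v a => ?_) s).trans (le_of_eq (by ring))
  · simp [volSumAdd]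
  · exact pathSum_time_le _ _ _ _ _ ((bfs_spec hG A r).2.2 v)

/-! ### Comparison with the natural logarithm and the diameter -/

theorem half_le_log {n : ℕ} (hn : 2 ≤ n) : (1 : ℝ) / 2 ≤ Real.log n := by
  have h1 : Real.log 2 ≤ Real.log n := Real.log_le_log (by norm_num) (by exact_mod_cast hn)
  linarith [Real.log_two_gt_d9]

theorem natLog_le_two_mul_log {n : ℕ} (hn : 2 ≤ n) : (Nat.log 2 n : ℝ) ≤ 2 * Real.log n := by
  have h1 : ((2 ^ Nat.log 2 n : ℕ) : ℝ) ≤ n := by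
    exact_mod_cast Nat.pow_log_le_self 2 (by omega)
  have h2 := Real.log_le_log (by positivity) h1
  push_cast at h2
  rw [Real.log_pow] at h2
  have h3 : (0 : ℝ) ≤ Nat.log 2 n := by positivity
  nlinarith [Real.log_two_gt_d9]

theorem one_le_diam (hn : 2 ≤ n) (hG : G.Connected) : 1 ≤ G.diam := by
  have : NeZero n := ⟨by omega⟩
  have : Nontrivial (Fin n) := Fin.nontrivial_iff_two_le.2 hn
  exact Nat.one_le_iff_ne_zero.2
    (SimpleGraph.diam_ne_zero_of_ediam_ne_top (SimpleGraph.connected_iff_ediam_ne_top.1 hG))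

theorem processSample_bit_time_le_log (hn : 2 ≤ n) (hG : G.Connected) (A : AdjLists G)
    {r : Fin n} {τ : Parents n} (hτ : τ r = none) (s : ℤ × (ℕ → ℤ)) :
    ((processSample A r (preprocess A r).val .bit τ s).time : ℝ) ≤ 42 * (n * Real.log n) := by
  have h : ((processSample A r (preprocess A r).val .bit τ s).time : ℝ) ≤
      n * (16 + 5 * Nat.log 2 n) := by exact_mod_cast processSample_bit_time_le hG A hτ s
  refine h.trans ?_
  rw [mul_left_comm]
  gcongr
  -- The constant 42 is 32 + 10: `16 ≤ 32 * Real.log n` and `5 * Nat.log 2 n ≤ 10 * Real.log n`.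
  linarith [half_le_log hn, natLog_le_two_mul_log hn]

theorem processSample_path_time_le_diam (hn : 2 ≤ n) (hG : G.Connected) (A : AdjLists G)
    {r : Fin n} {τ : Parents n} (hτ : τ r = none) (s : ℤ × (ℕ → ℤ)) :
    ((processSample A r (preprocess A r).val .path τ s).time : ℝ) ≤ 10 * (n * G.diam) := by
  have h : ((processSample A r (preprocess A r).val .path τ s).time : ℝ) ≤
      n * (9 + (bfs A r).val.2) := by exact_mod_cast processSample_path_time_le hG A hτ s
  refine h.trans ?_
  rw [mul_left_comm]
  gcongr
  have h1 : ((bfs A r).val.2 : ℝ) ≤ G.diam := by exact_mod_cast (bfs_spec hG A r).2.1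
  have h2 : (1 : ℝ) ≤ G.diam := by exact_mod_cast one_le_diam hn hG
  linarith

/-- The height of the search tree is at most the diameter. If it is also at most `log₂ n`, the naive
cost is below both bounds; otherwise `log₂ n` is smaller than the diameter, and the cost of the
index tree is below both. -/
theorem processSample_mode_time_le (hn : 2 ≤ n) (hG : G.Connected) (A : AdjLists G)
    {r : Fin n} {τ : Parents n} (hτ : τ r = none) (s : ℤ × (ℕ → ℤ)) :
    ((processSample A r (preprocess A r).val (preprocess A r).val.mode τ s).time : ℝ) ≤
      42 * (n * min (G.diam : ℝ) (Real.log n)) := by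
  have hd : (1 : ℝ) ≤ G.diam := by exact_mod_cast one_le_diam hn hG
  have hl := half_le_log hn
  have hl2 := natLog_le_two_mul_log hn
  rw [mul_left_comm, preprocess_mode]
  split_ifs with h
  · have ht : ((processSample A r (preprocess A r).val .path τ s).time : ℝ) ≤
        n * (9 + (bfs A r).val.2) := by exact_mod_cast processSample_path_time_le hG A hτ s
    refine ht.trans ?_
    gcongr
    have h1 : ((bfs A r).val.2 : ℝ) ≤ G.diam := by exact_mod_cast (bfs_spec hG A r).2.1
    have h2 : ((bfs A r).val.2 : ℝ) ≤ Nat.log 2 n := by exact_mod_cast h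
    rcases min_cases (G.diam : ℝ) (Real.log n) with ⟨hm, -⟩ | ⟨hm, -⟩ <;> rw [hm] <;> linarith
  · have ht : ((processSample A r (preprocess A r).val .bit τ s).time : ℝ) ≤
        n * (16 + 5 * Nat.log 2 n) := by exact_mod_cast processSample_bit_time_le hG A hτ s
    refine ht.trans ?_
    gcongr
    have h1 : (Nat.log 2 n : ℝ) ≤ G.diam := by
      exact_mod_cast (not_le.1 h).le.trans (bfs_spec hG A r).2.1
    rcases min_cases (G.diam : ℝ) (Real.log n) with ⟨hm, -⟩ | ⟨hm, -⟩ <;> rw [hm] <;> linarith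

end Preprocessing

/-! ### Expected costs of randomized computations -/

theorem tsum_option_ennreal {α : Type} (f : Option α → ℝ≥0∞) :
    ∑' x, f x = f none + ∑' a, f (some a) := by
  have h : f = fun x => (if x = none then f none else 0) + x.elim 0 fun a => f (some a) := by
    funext x
    cases x <;> simp
  conv_lhs => rw [h]
  rw [ENNReal.tsum_add, tsum_eq_single none fun x hx => if_neg hx, if_pos rfl]
  congr 1
  refine ((Option.some_injective α).tsum_eq (f := fun x : Option α => x.elim 0 fun a => f (some a))
    fun x hx => ?_).symm
  cases x with
  | none => simp at hx
  | some a => exact ⟨a, rfl⟩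

theorem Prog.bind_apply {α β : Type} (p : Prog α) (f : α → Prog β) (t : ℕ)
    (b : Option (β × ℕ)) :
    (p >>= f) t b = p t none * (PMF.pure none : PMF (Option (β × ℕ))) b +
      ∑' a, ∑' s, p t (some (a, s)) * f a s b := by
  change (PMF.bind (p t) _) b = _
  rw [PMF.bind_apply, tsum_option_ennreal, ENNReal.tsum_prod']

theorem Prog.bind_assoc {α β γ : Type} (p : Prog α) (f : α → Prog β) (g : β → Prog γ) :
    (p >>= f) >>= g = p >>= fun a => f a >>= g := by
  funext t
  change PMF.bind (PMF.bind (p t) _) _ = PMF.bind (p t) _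
  rw [PMF.bind_bind]
  congr 1
  funext x
  rcases x with _ | ⟨a, s⟩
  · exact PMF.pure_bind _ _
  · rfl

theorem Prog.pure_bind {α β : Type} (a : α) (f : α → Prog β) : (pure a : Prog α) >>= f = f a := by
  funext t
  exact PMF.pure_bind _ _

/-- A cost limit does not influence a computation that stays below it. -/
def Lawful {α : Type} (p : Prog α) : Prop :=
  ∀ t a s, p t (some (a, s)) = if s ≤ t then p (t - s) (some (a, 0)) else 0

/-- The probability of the result `a` when there is no cost limit. -/
noncomputable def out {α : Type} (p : Prog α) (a : α) : ℝ≥0∞ := ∑' c, p c (some (a, 0))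

theorem tsum_ite_le_sub (F : ℕ → ℝ≥0∞) (s : ℕ) :
    ∑' t, (if s ≤ t then F (t - s) else 0) = ∑' c, F c := by
  rw [← (add_left_injective s).tsum_eq (f := fun t => if s ≤ t then F (t - s) else 0)]
  · simp
  · intro t ht
    by_cases h : s ≤ t
    · exact ⟨t - s, Nat.sub_add_cancel h⟩
    · simp [h] at ht

/-- A run exceeds the limit `t` either inside `p` or inside `f a` with the leftover `s`. By `hp` the
probability of leaving `s` depends only on the amount `t - s` consumed, so the double sum over `t`
and `s` factors. -/
theorem expectedCost_bind {α β : Type} {p : Prog α} (hp : Lawful p) (f : α → Prog β) :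
    expectedCost (p >>= f) = expectedCost p + ∑' a, out p a * expectedCost (f a) := by
  simp only [expectedCost, Prog.bind_apply, PMF.pure_apply, if_true, mul_one]
  rw [ENNReal.tsum_add, ENNReal.tsum_comm]
  congr 1
  refine tsum_congr fun a => ?_
  rw [ENNReal.tsum_comm, out]
  have h : ∀ s, ∑' t, p t (some (a, s)) * f a s none =
      (∑' c, p c (some (a, 0))) * f a s none := by
    intro s
    rw [← ENNReal.tsum_mul_right, ← tsum_ite_le_sub (fun c => p c (some (a, 0)) * f a s none) s]
    refine tsum_congr fun t => ?_
    rw [hp t a s]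
    split_ifs <;> simp
  simp only [h]
  rw [ENNReal.tsum_mul_left]

/-- Consuming `c ≤ N` units is the same as leaving `N - c` of the limit `N`. For fixed `N` these are
disjoint events of one probability distribution. -/
theorem Lawful.tsum_out_le {α : Type} {p : Prog α} (hp : Lawful p) : ∑' a, out p a ≤ 1 := by
  simp only [out]
  rw [ENNReal.tsum_comm, ENNReal.tsum_eq_iSup_nat]
  refine iSup_le fun N => ?_
  rcases N with _ | N
  · simp
  · have h : ∀ c ∈ Finset.range (N + 1), ∑' a, p c (some (a, 0)) =
        ∑' a, p N (some (a, N - c)) := by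
      intro c hc
      have hc' : c ≤ N := by simpa [Nat.lt_succ_iff] using hc
      refine tsum_congr fun a => ?_
      rw [hp N a (N - c), if_pos (Nat.sub_le _ _), Nat.sub_sub_self hc']
    rw [Finset.sum_congr rfl h, Finset.sum_range_reflect (fun s => ∑' a, p N (some (a, s))) (N + 1)
      |>.symm.trans (Finset.sum_congr rfl fun c _ => by rw [Nat.add_sub_cancel]) |>.symm]
    refine (ENNReal.sum_le_tsum _).trans ?_
    rw [ENNReal.tsum_comm, ← ENNReal.tsum_prod' (f := fun x => p N (some x)), ← (p N).tsum_coe,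
      tsum_option_ennreal]
    exact le_add_self

theorem expectedCost_bind_le {α β : Type} {p : Prog α} (hp : Lawful p) (f : α → Prog β)
    (K : ℝ≥0∞) (hK : ∀ a, out p a ≠ 0 → expectedCost (f a) ≤ K) :
    expectedCost (p >>= f) ≤ expectedCost p + K := by
  rw [expectedCost_bind hp]
  gcongr
  calc ∑' a, out p a * expectedCost (f a) ≤ ∑' a, out p a * K := by
        refine ENNReal.tsum_le_tsum fun a => ?_
        by_cases h : out p a = 0
        · simp [h]
        · gcongr
          exact hK a h
    _ = (∑' a, out p a) * K := ENNReal.tsum_mul_right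
    _ ≤ 1 * K := by gcongr; exact hp.tsum_out_le
    _ = K := one_mul K

theorem Lawful.bind {α β : Type} {p : Prog α} (hp : Lawful p) {f : α → Prog β}
    (hf : ∀ a, Lawful (f a)) : Lawful (p >>= f) := by
  intro t b s
  simp only [Prog.bind_apply, PMF.pure_apply, reduceCtorEq, if_false, mul_zero, zero_add]
  have h : ∀ a, ∑' s', p t (some (a, s')) * f a s' (some (b, s)) =
      ∑' c, p t (some (a, c + s)) * f a c (some (b, 0)) := by
    intro a
    rw [← tsum_ite_le_sub (fun c => p t (some (a, c + s)) * f a c (some (b, 0))) s]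
    refine tsum_congr fun s' => ?_
    rw [hf a s' b s]
    split_ifs with hs
    · rw [Nat.sub_add_cancel hs]
    · exact mul_zero _
  simp only [h]
  split_ifs with hs
  · refine tsum_congr fun a => tsum_congr fun c => ?_
    rw [hp t a (c + s), hp (t - s) a c]
    by_cases hc : c + s ≤ t
    · rw [if_pos hc, if_pos (by omega), Nat.sub_sub, add_comm s c]
    · rw [if_neg hc, if_neg (by omega)]
  · simp only [ENNReal.tsum_eq_zero]
    intro a c
    rw [hp t a (c + s), if_neg (by omega), zero_mul]

/-- A random result with law `μ`, at the cost `k`. -/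
noncomputable def delayed {α : Type} (k : ℕ) (μ : PMF α) : Prog α := fun t =>
  if k ≤ t then μ.map fun a => some (a, t - k) else PMF.pure none

theorem delayed_bind {α β : Type} (k : ℕ) (μ : PMF α) (f : α → Prog β) (t : ℕ) :
    (delayed k μ >>= f) t = if k ≤ t then μ.bind fun a => f a (t - k) else PMF.pure none := by
  change PMF.bind (delayed k μ t) _ = _
  rw [delayed]
  split_ifs
  · rw [PMF.bind_map]; rfl
  · exact PMF.pure_bind _ _

theorem expectedCost_delayed_bind {α β : Type} (k : ℕ) (μ : PMF α) (f : α → Prog β) :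
    expectedCost (delayed k μ >>= f) = k + ∑' a, μ a * expectedCost (f a) := by
  have h : ∀ t, (delayed k μ >>= f) t none = (if t < k then 1 else 0) +
      if k ≤ t then ∑' a, μ a * f a (t - k) none else 0 := by
    intro t
    rw [delayed_bind]
    by_cases hk : k ≤ t
    · simp [hk, not_lt.2 hk, PMF.bind_apply]
    · simp [hk, not_le.1 hk]
  simp only [expectedCost, h]
  rw [ENNReal.tsum_add, tsum_ite_le_sub (fun c => ∑' a, μ a * f a c none), ENNReal.tsum_comm]
  congr 1
  · rw [tsum_eq_sum (s := Finset.range k) fun t ht => by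
      simp only [Finset.mem_range] at ht; simp [ht]]
    rw [Finset.sum_congr rfl fun t ht => if_pos (Finset.mem_range.1 ht)]
    simp
  · simp [ENNReal.tsum_mul_left]

theorem Lawful.delayed_bind {α β : Type} (k : ℕ) (μ : PMF α) {f : α → Prog β}
    (hf : ∀ a, Lawful (f a)) : Lawful (delayed k μ >>= f) := by
  intro t b s
  rw [KemenyTTF.delayed_bind, KemenyTTF.delayed_bind]
  by_cases hk : k ≤ t
  · rw [if_pos hk, PMF.bind_apply]
    simp only [hf _ (t - k) b s]
    by_cases hs : s ≤ t - k
    · rw [if_pos (by omega), if_pos (by omega), PMF.bind_apply]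
      simp only [hs, if_true, show t - s - k = t - k - s by omega]
    · simp only [hs, if_false, mul_zero, tsum_zero]
      split_ifs
      · omega
      · simp
      · rfl
  · rw [if_neg hk]
    split_ifs
    · omega
    · simp
    · simp

theorem runTimed_eq_delayed {α : Type} (w : CostModel) (c : Timed α) :
    runTimed w c = delayed (w.basic * c.time) (PMF.pure c.val) := by
  funext t
  simp only [runTimed, delayed, PMF.pure_map]

theorem expectedCost_pure {α : Type} (a : α) : expectedCost (pure a : Prog α) = 0 := by
  have : ∀ t, (pure a : Prog α) t = PMF.pure (some (a, t)) := fun _ => rfl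
  simp [expectedCost, this]

theorem Lawful.pure {α : Type} (a : α) : Lawful (pure a : Prog α) := by
  intro t b s
  have : ∀ t, (Pure.pure a : Prog α) t = PMF.pure (some (a, t)) := fun _ => rfl
  rw [this, this, PMF.pure_apply, PMF.pure_apply]
  have h : some (b, s) = some (a, t) ↔ s ≤ t ∧ some (b, 0) = some (a, t - s) := by
    simp only [Option.some.injEq, Prod.mk.injEq]
    constructor
    · rintro ⟨h, rfl⟩; simp [h]
    · rintro ⟨h1, h2, h3⟩; exact ⟨h2, by omega⟩
  by_cases h1 : some (b, s) = some (a, t)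
  · rw [if_pos h1, if_pos (h.1 h1).1, if_pos (h.1 h1).2]
  · rw [if_neg h1]
    split_ifs with hs h2
    · exact absurd (h.2 ⟨hs, h2⟩) h1
    · rfl
    · rfl

theorem Lawful.runTimed_bind {α β : Type} (w : CostModel) (c : Timed α) {f : α → Prog β}
    (hf : ∀ a, Lawful (f a)) : Lawful (runTimed w c >>= f) := by
  rw [runTimed_eq_delayed]
  exact Lawful.delayed_bind _ _ hf

theorem expectedCost_runTimed_bind {α β : Type} (w : CostModel) (c : Timed α) (f : α → Prog β) :
    expectedCost (runTimed w c >>= f) = (w.basic * c.time : ℕ) + expectedCost (f c.val) := by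
  rw [runTimed_eq_delayed, expectedCost_delayed_bind]
  congr 1
  rw [tsum_eq_single c.val fun a ha => by simp [ha]]
  simp

/-! ### Possible results of randomized computations -/

/-- All results that are returned with positive probability satisfy `Q`. -/
def Ensures {α : Type} (p : Prog α) (Q : α → Prop) : Prop :=
  ∀ t a s, p t (some (a, s)) ≠ 0 → Q a

theorem Ensures.of_out {α : Type} {p : Prog α} {Q : α → Prop} (h : Ensures p Q) {a : α}
    (ha : out p a ≠ 0) : Q a := by
  rw [out, Ne, ENNReal.tsum_eq_zero, not_forall] at ha
  obtain ⟨c, hc⟩ := ha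
  exact h c a 0 hc

theorem Ensures.bind {α β : Type} {p : Prog α} {f : α → Prog β} {Q : α → Prop} {R : β → Prop}
    (hp : Ensures p Q) (hf : ∀ a, Q a → Ensures (f a) R) : Ensures (p >>= f) R := by
  intro t b s h
  rw [Prog.bind_apply, PMF.pure_apply] at h
  simp only [reduceCtorEq, if_false, mul_zero, zero_add, ne_eq, ENNReal.tsum_eq_zero,
    not_forall, mul_eq_zero, not_or] at h
  obtain ⟨a, s', h1, h2⟩ := h
  exact hf a (hp t a s' h1) s' b s h2

theorem Ensures.pure {α : Type} {a : α} {Q : α → Prop} (h : Q a) : Ensures (pure a : Prog α) Q := by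
  intro t b s hb
  have : (Pure.pure a : Prog α) t = PMF.pure (some (a, t)) := rfl
  rw [this, PMF.pure_apply] at hb
  split_ifs at hb with hh
  · simp only [Option.some.injEq, Prod.mk.injEq] at hh
    exact hh.1 ▸ h
  · exact absurd rfl hb

theorem Ensures.delayed {α : Type} (k : ℕ) (μ : PMF α) {Q : α → Prop}
    (h : ∀ a, μ a ≠ 0 → Q a) : Ensures (delayed k μ) Q := by
  intro t b s hb
  rw [KemenyTTF.delayed] at hb
  split_ifs at hb
  · rw [← PMF.mem_support_iff, PMF.mem_support_map_iff] at hb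
    obtain ⟨a, ha, hab⟩ := hb
    simp only [Option.some.injEq, Prod.mk.injEq] at hab
    exact hab.1 ▸ h a ha
  · simp at hb

theorem Ensures.runTimed {α : Type} (w : CostModel) (c : Timed α) {Q : α → Prop} (h : Q c.val) :
    Ensures (runTimed w c) Q := by
  rw [runTimed_eq_delayed]
  refine Ensures.delayed _ _ fun a ha => ?_
  rw [← PMF.mem_support_iff, PMF.mem_support_pure_iff] at ha
  exact ha ▸ h

/-! ### Random walks as randomized computations -/

section Walk

theorem randomNeighbor_eq_delayed {n : ℕ} {G : SimpleGraph (Fin n)} (A : AdjLists G) (w : CostModel) (u : Fin n)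
    (h : (A.nbrs u).toFinset.Nonempty) :
    randomNeighbor w A u = delayed w.draw (PMF.uniformOfFinset (A.nbrs u).toFinset h) := by
  funext t
  simp only [randomNeighbor, delayed, h, dite_true]

variable {n : ℕ} {G : SimpleGraph (Fin n)} [DecidableRel G.Adj]

theorem degree_ne_zero (hn : 2 ≤ n) (hG : G.Connected) (u : Fin n) : G.degree u ≠ 0 := by
  have : Nontrivial (Fin n) := Fin.nontrivial_iff_two_le.2 hn
  exact (hG.preconnected.degree_pos_of_nontrivial u).ne'

theorem transitionMatrix_apply (h : ∀ u, G.degree u ≠ 0) (u v : Fin n) :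
    transitionMatrix G u v = if G.Adj u v then (G.degree u : ℝ)⁻¹ else 0 := by
  have hinv : (Matrix.diagonal fun v => (G.degree v : ℝ))⁻¹ =
      Matrix.diagonal fun v => (G.degree v : ℝ)⁻¹ := by
    refine Matrix.inv_eq_right_inv ?_
    rw [Matrix.diagonal_mul_diagonal, ← Matrix.diagonal_one]
    congr 1
    funext v
    exact mul_inv_cancel₀ (by exact_mod_cast h v)
  rw [transitionMatrix, hinv, Matrix.diagonal_mul, SimpleGraph.adjMatrix_apply]
  split_ifs <;> simp

theorem transitionMatrix_nonneg (h : ∀ u, G.degree u ≠ 0) (u v : Fin n) :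
    0 ≤ transitionMatrix G u v := by
  rw [transitionMatrix_apply h]
  split_ifs <;> positivity

theorem transitionMatrix_pos (h : ∀ u, G.degree u ≠ 0) {u v : Fin n} (huv : G.Adj u v) :
    0 < transitionMatrix G u v := by
  rw [transitionMatrix_apply h, if_pos huv]
  have := Nat.pos_of_ne_zero (h u)
  positivity

theorem adj_of_transitionMatrix_ne_zero (h : ∀ u, G.degree u ≠ 0) {u v : Fin n}
    (huv : transitionMatrix G u v ≠ 0) : G.Adj u v := by
  rw [transitionMatrix_apply h] at huv
  by_contra hc
  exact huv (if_neg hc)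

theorem sum_transitionMatrix (h : ∀ u, G.degree u ≠ 0) (u : Fin n) :
    ∑ v, transitionMatrix G u v = 1 := by
  simp only [transitionMatrix_apply h]
  rw [← Finset.sum_filter, Finset.sum_const, ← SimpleGraph.neighborFinset_eq_filter,
    SimpleGraph.card_neighborFinset_eq_degree, nsmul_eq_mul]
  exact mul_inv_cancel₀ (by exact_mod_cast h u)

variable (A : AdjLists G)

theorem nbrs_toFinset_nonempty (h : ∀ u, G.degree u ≠ 0) (u : Fin n) :
    (A.nbrs u).toFinset.Nonempty := by
  rw [← Finset.card_pos, A.toFinset_nbrs, SimpleGraph.card_neighborFinset_eq_degree]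
  exact Nat.pos_of_ne_zero (h u)

theorem uniformOfFinset_nbrs_apply (h : ∀ u, G.degree u ≠ 0) (u x : Fin n) :
    PMF.uniformOfFinset (A.nbrs u).toFinset (nbrs_toFinset_nonempty A h u) x =
      ENNReal.ofReal (transitionMatrix G u x) := by
  rw [PMF.uniformOfFinset_apply, transitionMatrix_apply h, A.toFinset_nbrs,
    SimpleGraph.card_neighborFinset_eq_degree]
  simp only [SimpleGraph.mem_neighborFinset]
  split_ifs
  · rw [ENNReal.ofReal_inv_of_pos (by exact_mod_cast Nat.pos_of_ne_zero (h u)),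
      ENNReal.ofReal_natCast]
  · simp

theorem expectedCost_randomNeighbor_bind (h : ∀ u, G.degree u ≠ 0) (w : CostModel) (u : Fin n)
    {β : Type} (f : Fin n → Prog β) :
    expectedCost (randomNeighbor w A u >>= f) =
      w.draw + ∑ x, ENNReal.ofReal (transitionMatrix G u x) * expectedCost (f x) := by
  rw [randomNeighbor_eq_delayed A w u (nbrs_toFinset_nonempty A h u), expectedCost_delayed_bind,
    tsum_fintype]
  simp only [uniformOfFinset_nbrs_apply A h]

theorem ensures_randomNeighbor (h : ∀ u, G.degree u ≠ 0) (w : CostModel) (u : Fin n) :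
    Ensures (randomNeighbor w A u) fun x => G.Adj u x := by
  rw [randomNeighbor_eq_delayed A w u (nbrs_toFinset_nonempty A h u)]
  refine Ensures.delayed _ _ fun x hx => ?_
  rw [uniformOfFinset_nbrs_apply A h] at hx
  exact adj_of_transitionMatrix_ne_zero h fun h0 => hx (by simp [h0])

variable {w : CostModel} (hdraw : 1 ≤ w.draw) (h : ∀ u, G.degree u ≠ 0)
  (inTree : Fin n → Bool)

include hdraw h in
-- A round that does not end the loop pays for at least one draw, so the limit runs out before the
-- round counter does.
theorem walkRounds_succ_of_le (f t : ℕ) (hf : t + 2 ≤ f) (u : Fin n) (next : Parents n) :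
    walkRounds w A inTree (f + 1) u next t = walkRounds w A inTree f u next t := by
  induction f generalizing t u next with
  | zero => omega
  | succ f ih =>
    rw [walkRounds, walkRounds, runTimed_eq_delayed, delayed_bind, delayed_bind]
    split_ifs with hb hu
    · rfl
    · congr 1
      funext _
      rw [randomNeighbor_eq_delayed A w u (nbrs_toFinset_nonempty A h u), delayed_bind,
        delayed_bind]
      split_ifs with hd
      · congr 1
        funext x
        exact ih _ (by omega) _ _
      · rfl
    · rfl

include hdraw h in
theorem walkRounds_eq_of_le (f t : ℕ) (hf : t + 2 ≤ f) (u : Fin n) (next : Parents n) :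
    walkRounds w A inTree f u next t = walkRounds w A inTree (t + 2) u next t := by
  induction f, hf using Nat.le_induction with
  | base => rfl
  | succ f hf ih => rw [walkRounds_succ_of_le A hdraw h inTree f t hf, ih]

include hdraw h in
-- The fixed-point equation of the loop. The round counter disappears because the rest of the walk
-- may be restarted with the counter belonging to its own remaining limit.
theorem walk_eq (u : Fin n) (next : Parents n) :
    walk w A inTree u next = runTimed w tick >>= fun _ =>
      if inTree u then pure next
      else randomNeighbor w A u >>= fun x =>
        walk w A inTree x (Function.update next u (some x)) := by
  funext t
  rw [walk, walkRounds, runTimed_eq_delayed, delayed_bind, delayed_bind]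
  split_ifs with hb hu
  · rfl
  · congr 1
    funext _
    rw [randomNeighbor_eq_delayed A w u (nbrs_toFinset_nonempty A h u), delayed_bind,
      delayed_bind]
    split_ifs with hd
    · congr 1
      funext x
      exact walkRounds_eq_of_le A hdraw h inTree _ _ (by omega) _ _
    · rfl
  · rfl

include h in
theorem walkRounds_lawful (f : ℕ) (u : Fin n) (next : Parents n) :
    Lawful (walkRounds w A inTree f u next) := by
  induction f generalizing u next with
  | zero => intro t a s; simp [walkRounds]
  | succ f ih =>
    rw [walkRounds]
    refine Lawful.runTimed_bind _ _ fun _ => ?_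
    split_ifs
    · exact Lawful.pure _
    · rw [randomNeighbor_eq_delayed A w u (nbrs_toFinset_nonempty A h u)]
      exact Lawful.delayed_bind _ _ fun x => ih _ _

include hdraw h in
theorem walk_lawful (u : Fin n) (next : Parents n) : Lawful (walk w A inTree u next) := by
  intro t a s
  rw [walk, walk, walkRounds_lawful A h inTree (t + 2) u next t a s]
  split_ifs with hs
  · rw [walkRounds_eq_of_le A hdraw h inTree (t + 2) (t - s) (by omega)]
  · rfl

include h in
theorem wilson_fold_lawful (hdraw : 1 ≤ w.draw) (l : List (Fin n))
    (s : (Fin n → Bool) × Parents n) :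
    Lawful (l.foldlM (fun (s : (Fin n → Bool) × Parents n) v => (do
      let next ← walk w A s.1 v s.2
      let inTree ← runTimed w (addPath next n v s.1)
      return (inTree, next) : Prog _)) s) := by
  induction l generalizing s with
  | nil => exact Lawful.pure _
  | cons v l ih =>
    rw [List.foldlM_cons]
    refine Lawful.bind ?_ ih
    refine (walk_lawful A hdraw h _ _ _).bind fun next => ?_
    exact Lawful.runTimed_bind _ _ fun _ => Lawful.pure _

include h in
theorem wilson_lawful (hdraw : 1 ≤ w.draw) (r : Fin n) : Lawful (wilson w A r) :=
  Lawful.runTimed_bind _ _ fun _ => (wilson_fold_lawful A h hdraw _ _).bind fun _ => Lawful.pure _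

end Walk

/-! ### Green functions of killed Markov chains -/

section Green

variable {V : Type*} [Fintype V] [DecidableEq V]

/-- An irreducible stochastic matrix. -/
structure IsChain (P : Matrix V V ℝ) : Prop where
  nonneg : ∀ u v, 0 ≤ P u v
  sum_eq_one : ∀ u, ∑ v, P u v = 1
  reachable : ∀ u v, Relation.ReflTransGen (fun a b => 0 < P a b) u v

/-- The inverse of `I - P` with the rows of `P` in `B` replaced by zero. For `z ∉ B` the entry at
`(u, z)` is the expected number of visits to `z` of the chain started at `u` before it hits `B`;
for `z ∈ B` it is the probability that `B` is hit at `z`. -/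
noncomputable def green (P : Matrix V V ℝ) (B : Finset V) : Matrix V V ℝ :=
  (1 - Matrix.of fun u v => if u ∈ B then 0 else P u v)⁻¹

variable {P : Matrix V V ℝ} (hP : IsChain P) {B : Finset V}

omit [DecidableEq V] in
include hP in
-- At a minimum outside `B`, superharmonicity forces every successor of positive probability to be a
-- minimum as well. Irreducibility carries a negative minimum into `B`, where it is excluded.
theorem IsChain.min_principle (hB : B.Nonempty) {f : V → ℝ} (h0 : ∀ u ∈ B, 0 ≤ f u)
    (h1 : ∀ u, u ∉ B → ∑ y, P u y * f y ≤ f u) (u : V) : 0 ≤ f u := by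
  obtain ⟨b, hb⟩ := hB
  obtain ⟨m, -, hm⟩ := Finset.exists_min_image Finset.univ f ⟨b, Finset.mem_univ b⟩
  refine le_trans ?_ (hm u (Finset.mem_univ u))
  by_contra! hneg
  have key : ∀ v, Relation.ReflTransGen (fun a b => 0 < P a b) m v → f v = f m := by
    intro v hv
    induction hv with
    | refl => rfl
    | @tail a c _ hac ih =>
      have ha : a ∉ B := fun haB => by
        have := h0 a haB
        rw [ih] at this
        linarith
      have hsum : ∑ y, P a y * (f y - f m) ≤ 0 := by
        simp only [mul_sub, Finset.sum_sub_distrib]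
        rw [← Finset.sum_mul, hP.sum_eq_one, one_mul, ← ih]
        linarith [h1 a ha]
      have hnn : ∀ y ∈ Finset.univ, 0 ≤ P a y * (f y - f m) := fun y hy =>
        mul_nonneg (hP.nonneg a y) (sub_nonneg.2 (hm y hy))
      have := (Finset.sum_eq_zero_iff_of_nonneg hnn).1
        (le_antisymm hsum (Finset.sum_nonneg hnn)) c (Finset.mem_univ c)
      rcases mul_eq_zero.1 this with h | h
      · exact absurd h hac.ne'
      · linarith
  have := h0 b hb
  rw [key b (hP.reachable m b)] at this
  linarith

omit [DecidableEq V] in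
include hP in
-- Uniqueness for the Dirichlet problem. It replaces path counting: Green function identities are
-- checked by comparing both sides on the boundary and under `I - P` off it.
theorem IsChain.ext_of_harmonic (hB : B.Nonempty) {f g : V → ℝ} (h0 : ∀ u ∈ B, f u = g u)
    (h1 : ∀ u, u ∉ B → f u - ∑ y, P u y * f y = g u - ∑ y, P u y * g y) (u : V) :
    f u = g u := by
  refine le_antisymm ?_ ?_
  · refine sub_nonneg.1 (hP.min_principle hB (f := fun u => g u - f u) (fun u hu => ?_)
      (fun u hu => ?_) u)
    · simp [h0 u hu]
    · simp only [mul_sub, Finset.sum_sub_distrib]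
      linarith [h1 u hu]
  · refine sub_nonneg.1 (hP.min_principle hB (f := fun u => f u - g u) (fun u hu => ?_)
      (fun u hu => ?_) u)
    · simp [h0 u hu]
    · simp only [mul_sub, Finset.sum_sub_distrib]
      linarith [h1 u hu]

theorem killed_mulVec (B : Finset V) (f : V → ℝ) (u : V) :
    (1 - Matrix.of fun u v => if u ∈ B then 0 else P u v : Matrix V V ℝ).mulVec f u =
      f u - if u ∈ B then 0 else ∑ y, P u y * f y := by
  rw [Matrix.sub_mulVec, Matrix.one_mulVec, Pi.sub_apply]
  congr 1
  simp only [Matrix.mulVec, dotProduct, Matrix.of_apply]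
  split_ifs <;> simp

include hP in
theorem IsChain.isUnit_killed (hB : B.Nonempty) :
    IsUnit (1 - Matrix.of fun u v => if u ∈ B then 0 else P u v : Matrix V V ℝ) := by
  refine Matrix.mulVec_injective_iff_isUnit.1 fun f g hfg => funext fun u => ?_
  have h : ∀ u, _ := fun u => congrFun hfg u
  simp only [killed_mulVec] at h
  refine hP.ext_of_harmonic hB (fun u hu => ?_) (fun u hu => ?_) u
  · simpa [hu] using h u
  · simpa [hu] using h u

include hP in
theorem IsChain.killed_mul_green (hB : B.Nonempty) (u z : V) :
    green P B u z - (if u ∈ B then 0 else ∑ y, P u y * green P B y z) =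
      if u = z then 1 else 0 := by
  have h := Matrix.mul_nonsing_inv _ ((Matrix.isUnit_iff_isUnit_det _).1 (hP.isUnit_killed hB))
  have h2 := congrFun (congrFun h u) z
  rw [Matrix.one_apply] at h2
  rw [← h2]
  exact (killed_mulVec B (fun y => green P B y z) u).symm

include hP in
theorem IsChain.green_of_mem {u : V} (hu : u ∈ B) (z : V) :
    green P B u z = if u = z then 1 else 0 := by
  simpa [hu] using hP.killed_mul_green ⟨u, hu⟩ u z

include hP in
theorem IsChain.green_of_notMem (hB : B.Nonempty) {u : V} (hu : u ∉ B) (z : V) :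
    green P B u z = (if u = z then 1 else 0) + ∑ y, P u y * green P B y z := by
  have := hP.killed_mul_green hB u z
  rw [if_neg hu] at this
  linarith

include hP in
theorem IsChain.green_nonneg (hB : B.Nonempty) (u z : V) : 0 ≤ green P B u z := by
  refine hP.min_principle hB (f := fun u => green P B u z) (fun u hu => ?_) (fun u hu => ?_) u
  · rw [hP.green_of_mem hu]
    split_ifs <;> norm_num
  · rw [hP.green_of_notMem hB hu]
    split_ifs <;> linarith

include hP in
theorem IsChain.one_le_green_self (hB : B.Nonempty) (u : V) : 1 ≤ green P B u u := by
  by_cases hu : u ∈ B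
  · simp [hP.green_of_mem hu]
  · rw [hP.green_of_notMem hB hu, if_pos rfl, le_add_iff_nonneg_right]
    exact Finset.sum_nonneg fun y _ => mul_nonneg (hP.nonneg u y) (hP.green_nonneg hB y u)

include hP in
theorem IsChain.sum_green_boundary (hB : B.Nonempty) (u : V) : ∑ z ∈ B, green P B u z = 1 := by
  refine hP.ext_of_harmonic hB (f := fun u => ∑ z ∈ B, green P B u z) (g := fun _ => 1)
    (fun u hu => ?_) (fun u hu => ?_) u
  · simp only [hP.green_of_mem hu]
    simp [hu]
  · simp only [mul_one, hP.sum_eq_one, sub_self, Finset.mul_sum]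
    rw [Finset.sum_comm, ← Finset.sum_sub_distrib]
    refine Finset.sum_eq_zero fun z hz => ?_
    rw [hP.green_of_notMem hB hu, if_neg (fun h => hu (h ▸ hz) : ¬ u = z)]
    ring

/-! ### Decompositions of the Green function at visits to a vertex -/

include hP in
-- First passage: `u` must be reached before `B`, and from there the visits to `u` are those of a
-- chain started at `u`.
theorem IsChain.green_insert_mul (hB : B.Nonempty) {u : V} (hu : u ∉ B) (y : V) :
    green P B y u = green P (insert u B) y u * green P B u u := by
  have hI := Finset.insert_nonempty u B
  refine hP.ext_of_harmonic hI (f := fun y => green P B y u)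
    (g := fun y => green P (insert u B) y u * green P B u u) (fun y hy => ?_) (fun y hy => ?_) y
  · rw [hP.green_of_mem hy]
    rcases Finset.mem_insert.1 hy with rfl | hy
    · simp
    · rw [hP.green_of_mem hy, if_neg (fun h => hu (h ▸ hy) : ¬ y = u), zero_mul]
  · rw [Finset.mem_insert, not_or] at hy
    rw [hP.green_of_notMem hB hy.2, hP.green_of_notMem hI (by simp [hy.1, hy.2]), if_neg hy.1]
    simp only [zero_add, Finset.sum_mul, mul_assoc, sub_self]

include hP in
-- The visits to `z` are split into those before and those after the first visit to `u`.
theorem IsChain.green_eq_insert_add (hB : B.Nonempty) {u z : V} (hu : u ∉ B) (hz : z ≠ u) (y : V) :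
    green P B y z = green P (insert u B) y z + green P (insert u B) y u * green P B u z := by
  have hI := Finset.insert_nonempty u B
  refine hP.ext_of_harmonic hI (f := fun y => green P B y z)
    (g := fun y => green P (insert u B) y z + green P (insert u B) y u * green P B u z)
    (fun y hy => ?_) (fun y hy => ?_) y
  · rw [hP.green_of_mem hy, hP.green_of_mem hy]
    rcases Finset.mem_insert.1 hy with rfl | hy
    · simp [hz.symm]
    · rw [hP.green_of_mem hy, if_neg (fun h => hu (h ▸ hy) : ¬ y = u)]
      ring
  · have hy' := hy
    rw [Finset.mem_insert, not_or] at hy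
    rw [hP.green_of_notMem hB hy.2, hP.green_of_notMem hI hy', hP.green_of_notMem hI hy',
      if_neg hy.1]
    simp only [mul_add, Finset.sum_add_distrib, ← mul_assoc, ← Finset.sum_mul]
    ring

include hP in
-- The number of visits to `u` is geometric, with the probability of not returning as its parameter.
theorem IsChain.green_self_mul_escape (hB : B.Nonempty) {u : V} (hu : u ∉ B) :
    green P B u u * (1 - ∑ y, P u y * green P (insert u B) y u) = 1 := by
  have h1 := hP.green_of_notMem hB hu u
  rw [if_pos rfl, Finset.sum_congr rfl fun y _ => by rw [hP.green_insert_mul hB hu y]] at h1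
  simp only [← mul_assoc, ← Finset.sum_mul] at h1
  linarith

include hP in
-- Last exit: each visit to `z` belongs to exactly one excursion from `u`, and one excursion starts
-- at each visit to `u`.
theorem IsChain.green_eq_mul_sum (hB : B.Nonempty) {u z : V} (hu : u ∉ B) (hz : z ≠ u) :
    green P B u z = green P B u u * ∑ y, P u y * green P (insert u B) y z := by
  have h1 := hP.green_of_notMem hB hu z
  rw [if_neg hz.symm, Finset.sum_congr rfl fun y _ => by
    rw [hP.green_eq_insert_add hB hu hz y]] at h1
  simp only [mul_add, Finset.sum_add_distrib, ← mul_assoc, ← Finset.sum_mul, zero_add] at h1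
  have h2 := hP.green_self_mul_escape hB hu
  linear_combination green P B u u * h1 - green P B u z * h2

include hP in
-- Both sides are the 2 × 2 determinant of `green P B` on `{u, x}`, which is symmetric in `u` and
-- `x`.
theorem IsChain.green_mul_green_insert (hB : B.Nonempty) {u x : V} (hu : u ∉ B) (hx : x ∉ B)
    (hux : x ≠ u) :
    green P B x x * green P (insert x B) u u = green P B u u * green P (insert u B) x x := by
  have h1 := hP.green_eq_insert_add hB hu hux x
  have h2 := hP.green_eq_insert_add hB hx hux.symm u
  have h3 := hP.green_insert_mul hB hu x
  have h4 := hP.green_insert_mul hB hx u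
  linear_combination (green P B u u) * h1 - (green P B x x) * h2 + green P B x u * h4 -
    green P B u x * h3

/-- The expected time at which `B` is hit. -/
noncomputable def hitTime (P : Matrix V V ℝ) (B : Finset V) (u : V) : ℝ := ∑ x ∈ Bᶜ, green P B u x

/-- The trace of the Green function. -/
noncomputable def greenTrace (P : Matrix V V ℝ) (B : Finset V) : ℝ := ∑ x ∈ Bᶜ, green P B x x

include hP in
theorem IsChain.hitTime_of_mem {u : V} (hu : u ∈ B) : hitTime P B u = 0 := by
  refine Finset.sum_eq_zero fun x hx => ?_
  rw [hP.green_of_mem hu, if_neg]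
  rintro rfl
  exact Finset.mem_compl.1 hx hu

include hP in
theorem IsChain.hitTime_of_notMem (hB : B.Nonempty) {u : V} (hu : u ∉ B) :
    hitTime P B u = 1 + ∑ y, P u y * hitTime P B y := by
  simp only [hitTime, Finset.mul_sum]
  rw [Finset.sum_comm, Finset.sum_congr rfl fun x _ => hP.green_of_notMem hB hu x,
    Finset.sum_add_distrib]
  simp [hu]

include hP in
theorem IsChain.hitTime_nonneg (hB : B.Nonempty) (u : V) : 0 ≤ hitTime P B u :=
  Finset.sum_nonneg fun x _ => hP.green_nonneg hB u x

include hP in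
theorem IsChain.greenTrace_nonneg (hB : B.Nonempty) : 0 ≤ greenTrace P B :=
  Finset.sum_nonneg fun x _ => hP.green_nonneg hB x x

end Green

/-! ### Loop-erased walks and the trace of the Green function -/

section LoopErasure

variable {V : Type*} [Fintype V] [DecidableEq V] (P : Matrix V V ℝ) (S : Finset V) (x : V)

/-- The expected number of visits to `x` of the chain started at `x` and killed on `B`, times the
probability that the chain started at `u` hits `B ∪ {x}` in `S`. -/
noncomputable def escapeGreen (B : Finset V) (u : V) : ℝ :=
  if x ∈ B then 0 else green P B x x * ∑ z ∈ S, green P (insert x B) u z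

/-- Let `β` be the current loop-erased path, in reverse order. This is the expectation of
the Green function at `(x, x)` of the complement of `S` and of the final loop-erased path, over the
event that the chain started at `y` returns to `β` before it hits `S`. -/
noncomputable def returnGreen : List V → V → ℝ
  | [], _ => 0
  | a :: β, y => returnGreen β y +
      green P (insert a (S ∪ β.toFinset)) y a * escapeGreen P S x (S ∪ β.toFinset) a

/-- The expectation of the Green function at `(x, x)` of the complement of `S` and of the final
loop-erased path, when the current loop-erased path consists of `β`, in reverse order, and `u`. -/
noncomputable def erasedGreen (β : List V) (u : V) : ℝ :=
  returnGreen P S x β u + escapeGreen P S x (S ∪ β.toFinset) u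

variable {P S} (hP : IsChain P) (hS : S.Nonempty)

include hP in
theorem returnGreen_of_mem {β : List V} (hβ : ∀ a ∈ β, a ∉ S) {y : V} (hy : y ∈ S) :
    returnGreen P S x β y = 0 := by
  induction β with
  | nil => rfl
  | cons a β ih =>
    have hya : ¬ y = a := fun h => hβ a (by simp) (h ▸ hy)
    rw [returnGreen, ih fun b hb => hβ b (by simp [hb]), hP.green_of_mem (by simp [hy]),
      if_neg hya]
    simp

include hP in
theorem returnGreen_of_notMem {β : List V} {y : V} (hy : y ∉ S) (hyβ : y ∉ β) :
    returnGreen P S x β y = ∑ z, P y z * returnGreen P S x β z := by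
  induction β with
  | nil => simp [returnGreen]
  | cons a β ih =>
    rw [List.mem_cons, not_or] at hyβ
    simp only [returnGreen, mul_add, Finset.sum_add_distrib]
    rw [← ih hyβ.2, hP.green_of_notMem (Finset.insert_nonempty _ _) (by simp [hyβ, hy]),
      if_neg hyβ.1, zero_add, Finset.sum_mul]
    simp only [mul_assoc]

include hP in
-- The summands of `returnGreen` classify the walks by the oldest vertex of the path that is met
-- again. A walk standing at `y` has met `y`, so the more recent vertices in `pre` contribute
-- nothing.
theorem returnGreen_append (pre β : List V) {y : V} (hnd : (pre ++ y :: β).Nodup) :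
    returnGreen P S x (pre ++ y :: β) y =
      returnGreen P S x β y + escapeGreen P S x (S ∪ β.toFinset) y := by
  induction pre with
  | nil => rw [List.nil_append, returnGreen, hP.green_of_mem (by simp)]; simp
  | cons a pre ih =>
    rw [List.cons_append, List.nodup_cons] at hnd
    have hya : ¬ y = a := fun h => hnd.1 (by simp [h])
    rw [List.cons_append, returnGreen, ih hnd.2, hP.green_of_mem (by simp), if_neg hya]
    simp

include hP in
theorem escapeGreen_of_mem {B : Finset V} {y : V} (hy : y ∈ B) (hyS : y ∉ S) :
    escapeGreen P S x B y = 0 := by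
  rw [escapeGreen]
  split_ifs with hx
  · rfl
  · rw [Finset.sum_eq_zero, mul_zero]
    intro z hz
    rw [hP.green_of_mem (Finset.mem_insert_of_mem hy), if_neg]
    rintro rfl
    exact hyS hz

include hP hS in
-- Outside the degenerate cases `x ∈ B` and `x = u`, where both sides vanish, last exit from `u` in
-- the chain killed on `B ∪ {x}` produces the factor `green P (insert x B) u u`. The symmetry
-- `green_mul_green_insert` exchanges `u` and `x`, and the remaining `green P B u u` cancels against
-- the escape probability.
theorem escapeGreen_mul_escape {B : Finset V} (hSB : S ⊆ B) {u : V} (hu : u ∉ B) :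
    escapeGreen P S x B u * (1 - ∑ y, P u y * green P (insert u B) y u) =
      ∑ y, P u y * escapeGreen P S x (insert u B) y := by
  have hB := hS.mono hSB
  by_cases hx : x ∈ B
  · simp [escapeGreen, hx]
  by_cases hux : x = u
  · subst hux
    have h0 : ∑ z ∈ S, green P (insert x B) x z = 0 := by
      refine Finset.sum_eq_zero fun z hz => ?_
      rw [hP.green_of_mem (by simp), if_neg]
      rintro rfl
      exact hu (hSB hz)
    simp [escapeGreen, h0]
  · have hux' : u ∉ insert x B := by simp [hu, Ne.symm hux]
    have h1 : ∀ z ∈ S, green P (insert x B) u z = green P (insert x B) u u *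
        ∑ y, P u y * green P (insert x (insert u B)) y z := fun z hz => by
      rw [hP.green_eq_mul_sum (Finset.insert_nonempty _ _) hux' fun h => hu (hSB (h ▸ hz)),
        Finset.insert_comm]
    have h2 : ∑ y, P u y * escapeGreen P S x (insert u B) y = green P (insert u B) x x *
        ∑ z ∈ S, ∑ y, P u y * green P (insert x (insert u B)) y z := by
      simp only [escapeGreen, Finset.mem_insert, hux, hx, or_self, if_false, Finset.mul_sum]
      rw [Finset.sum_comm]
      exact Finset.sum_congr rfl fun _ _ => Finset.sum_congr rfl fun _ _ => by ring
    rw [h2, escapeGreen, if_neg hx, Finset.sum_congr rfl h1, ← Finset.mul_sum]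
    have h3 := hP.green_mul_green_insert hB hu hx hux
    have h4 := hP.green_self_mul_escape hB hu
    generalize ∑ z ∈ S, ∑ y, P u y * green P (insert x (insert u B)) y z = R
    linear_combination (R * (1 - ∑ y, P u y * green P (insert u B) y u)) * h3 +
      (R * green P (insert u B) x x) * h4

include hP hS in
-- From `u` the walk meets an older vertex of `β` before `S`, or it avoids them. In the second case
-- it returns to `u` or not: the return term is the new summand of `returnGreen` for `u :: β`, and
-- `escapeGreen_mul_escape` supplies the other one.
theorem erasedGreen_step {β : List V} {u : V} (huS : u ∉ S) (huβ : u ∉ β) :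
    erasedGreen P S x β u = ∑ y, P u y * erasedGreen P S x (u :: β) y := by
  have hins : S ∪ (u :: β).toFinset = insert u (S ∪ β.toFinset) := by
    rw [List.toFinset_cons, Finset.union_insert]
  have hu : u ∉ S ∪ β.toFinset := by simp [huS, huβ]
  have h1 := escapeGreen_mul_escape x hP hS Finset.subset_union_left hu
  have h2 := returnGreen_of_notMem x hP huS huβ
  simp only [erasedGreen, returnGreen, hins, mul_add, Finset.sum_add_distrib, ← mul_assoc,
    ← Finset.sum_mul]
  linarith

include hP in
-- This is loop erasure: back at `y`, the loop `pre` may be forgotten without changing the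
-- expectation.
theorem erasedGreen_append (pre β : List V) {y : V} (hnd : (pre ++ y :: β).Nodup) (hy : y ∉ S) :
    erasedGreen P S x (pre ++ y :: β) y = erasedGreen P S x β y := by
  rw [erasedGreen, returnGreen_append x hP pre β hnd, 
    escapeGreen_of_mem x hP (B := S ∪ (pre ++ y :: β).toFinset) (by simp) hy,
    add_zero, erasedGreen]

include hP hS in
-- The value is `green P S x x` times the probability of hitting `S` before `x`.
theorem erasedGreen_nil (hx : x ∉ S) (v : V) :
    erasedGreen P S x [] v = green P S x x - green P S v x := by
  have h1 := hP.sum_green_boundary (Finset.insert_nonempty x S) v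
  rw [Finset.sum_insert hx] at h1
  have h2 := hP.green_insert_mul hS hx v
  simp only [erasedGreen, returnGreen, escapeGreen, List.toFinset_nil, Finset.union_empty, hx,
    if_false]
  linear_combination (green P S x x) * h1 + h2

include hP in
theorem erasedGreen_of_mem {β : List V} (hβ : ∀ a ∈ β, a ∉ S) {u : V} (hu : u ∈ S) :
    erasedGreen P S x β u =
      if x ∈ S ∪ β.toFinset then 0 else green P (S ∪ β.toFinset) x x := by
  rw [erasedGreen, returnGreen_of_mem x hP hβ hu, escapeGreen, zero_add]
  split_ifs with hx
  · rfl
  · rw [Finset.sum_congr rfl fun z _ => hP.green_of_mem (by simp [hu]) z,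
      Finset.sum_ite_eq, if_pos hu, mul_one]

variable (P S) in
/-- The expected number of steps which are still to be made in Wilson's algorithm when the tree
is `S` and the current loop-erased path consists of `β`, in reverse order, and `u`. -/
noncomputable def remainingSteps (β : List V) (u : V) : ℝ :=
  hitTime P S u + ∑ x ∈ Sᶜ, erasedGreen P S x β u

include hP hS in
theorem remainingSteps_step {β : List V} {u : V} (huS : u ∉ S) (huβ : u ∉ β) :
    remainingSteps P S β u = 1 + ∑ y, P u y * remainingSteps P S (u :: β) y := by
  simp only [remainingSteps, mul_add, Finset.sum_add_distrib, Finset.mul_sum]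
  rw [hP.hitTime_of_notMem hS huS, Finset.sum_comm (s := Finset.univ),
    Finset.sum_congr rfl fun x _ => erasedGreen_step x hP hS huS huβ, add_assoc]

include hP in
theorem remainingSteps_append (pre β : List V) {y : V} (hnd : (pre ++ y :: β).Nodup)
    (hy : y ∉ S) : remainingSteps P S (pre ++ y :: β) y = remainingSteps P S β y := by
  rw [remainingSteps, Finset.sum_congr rfl fun x _ => erasedGreen_append x hP pre β hnd hy,
    remainingSteps]

include hP hS in
-- The expected length of the present walk cancels against the expected loss of trace due to its
-- loop erasure, so the value does not depend on `v`.
theorem remainingSteps_nil (v : V) : remainingSteps P S [] v = greenTrace P S := by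
  rw [remainingSteps, Finset.sum_congr rfl fun x hx =>
    erasedGreen_nil x hP hS (Finset.mem_compl.1 hx) v, Finset.sum_sub_distrib, hitTime, greenTrace]
  ring

include hP in
theorem remainingSteps_of_mem {β : List V} (hβ : ∀ a ∈ β, a ∉ S) {u : V} (hu : u ∈ S) :
    remainingSteps P S β u = greenTrace P (S ∪ β.toFinset) := by
  rw [remainingSteps, hP.hitTime_of_mem hu, zero_add,
    Finset.sum_congr rfl fun x _ => erasedGreen_of_mem x hP hβ hu, greenTrace]
  rw [← Finset.sum_filter_add_sum_filter_not Sᶜ (fun x => x ∈ S ∪ β.toFinset),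
    Finset.sum_eq_zero fun x hx => if_pos (Finset.mem_filter.1 hx).2, zero_add,
    Finset.sum_congr rfl fun x hx => if_neg (Finset.mem_filter.1 hx).2]
  congr 1
  ext x
  simp

include hP hS in
/-- A bounded function of the state of a process driven by a chain which is harmonic until `S` is
hit, and vanishes then, is zero. -/
theorem eq_zero_of_harmonic {X : Type*} (pos : X → V) (f : X → ℝ) (K : ℝ) (hK : ∀ s, |f s| ≤ K)
    (h0 : ∀ s, pos s ∈ S → f s = 0)
    (h1 : ∀ s, pos s ∉ S → ∃ g : V → ℝ, f s = ∑ y, P (pos s) y * g y ∧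
      ∀ y, P (pos s) y ≠ 0 → ∃ s', pos s' = y ∧ g y = f s') (s : X) : f s = 0 := by
  -- The hitting time drops by one per step and is at most `H`, so averaging over a step multiplies
  -- it by at most `1 - 1 / H`. It serves as a weight that contracts geometrically.
  set H : ℝ := 1 + ∑ u, hitTime P S u with hH
  have hsum : ∀ u, hitTime P S u ≤ ∑ u, hitTime P S u := fun u =>
    Finset.single_le_sum (fun u _ => hP.hitTime_nonneg hS u) (Finset.mem_univ u)
  have hH1 : 1 ≤ H := by
    have := Finset.sum_nonneg fun u (_ : u ∈ Finset.univ) => hP.hitTime_nonneg hS u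
    linarith
  have hle : ∀ u, hitTime P S u ≤ H := fun u => by linarith [hsum u]
  have hq0 : 0 ≤ 1 - 1 / H := sub_nonneg.2 ((div_le_one (by linarith)).2 hH1)
  have hq1 : 1 - 1 / H < 1 := by
    have : 0 < 1 / H := by positivity
    linarith
  have hK0 : 0 ≤ K := (abs_nonneg _).trans (hK s)
  have key : ∀ (m : ℕ) (s : X), |f s| ≤ K * (1 - 1 / H) ^ m * hitTime P S (pos s) := by
    intro m
    induction m with
    | zero =>
      intro s
      by_cases hs : pos s ∈ S
      · simp [h0 s hs, hP.hitTime_of_mem hs]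
      · have h1 : 1 ≤ hitTime P S (pos s) := by
          rw [hP.hitTime_of_notMem hS hs, le_add_iff_nonneg_right]
          exact Finset.sum_nonneg fun y _ => mul_nonneg (hP.nonneg _ y) (hP.hitTime_nonneg hS y)
        rw [pow_zero, mul_one]
        exact (hK s).trans (le_mul_of_one_le_right hK0 h1)
    | succ m ih =>
      intro s
      by_cases hs : pos s ∈ S
      · simp [h0 s hs, hP.hitTime_of_mem hs]
      · obtain ⟨g, hg, hgs⟩ := h1 s hs
        have hc : 0 ≤ K * (1 - 1 / H) ^ m := by positivity
        calc |f s| ≤ ∑ y, |P (pos s) y * g y| := by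
              rw [hg]; exact Finset.abs_sum_le_sum_abs _ _
          _ ≤ ∑ y, P (pos s) y * (K * (1 - 1 / H) ^ m * hitTime P S y) := by
              refine Finset.sum_le_sum fun y _ => ?_
              rw [abs_mul, abs_of_nonneg (hP.nonneg _ y)]
              by_cases hy : P (pos s) y = 0
              · simp [hy]
              · obtain ⟨s', rfl, hs'⟩ := hgs y hy
                rw [hs']
                exact mul_le_mul_of_nonneg_left (ih s') (hP.nonneg _ _)
          _ = K * (1 - 1 / H) ^ m * (hitTime P S (pos s) - 1) := by
              rw [hP.hitTime_of_notMem hS hs, add_sub_cancel_left, Finset.mul_sum]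
              exact Finset.sum_congr rfl fun y _ => by ring
          _ ≤ K * (1 - 1 / H) ^ m * ((1 - 1 / H) * hitTime P S (pos s)) := by
              refine mul_le_mul_of_nonneg_left ?_ hc
              have : hitTime P S (pos s) / H ≤ 1 := (div_le_one (by linarith)).2 (hle _)
              rw [sub_mul, one_mul, one_div_mul_eq_div]
              linarith
          _ = K * (1 - 1 / H) ^ (m + 1) * hitTime P S (pos s) := by ring
  have hlim : Filter.Tendsto (fun m : ℕ => K * (1 - 1 / H) ^ m * hitTime P S (pos s)) Filter.atTop
      (nhds 0) := by
    have := ((tendsto_pow_atTop_nhds_zero_of_lt_one hq0 hq1).const_mul K).mul_const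
      (hitTime P S (pos s))
    simpa using this
  exact abs_nonpos_iff.1 (ge_of_tendsto' hlim fun m => key m s)

end LoopErasure

/-! ### Loop-erased paths in Wilson's algorithm -/

section LoopErased

variable {n : ℕ}

/-- The set of vertices of the tree. -/
def treeSet (S : Fin n → Bool) : Finset (Fin n) := Finset.univ.filter fun x => S x = true

/-- Add the vertices of `β` to the tree `S`. -/
def addList (S : Fin n → Bool) (β : List (Fin n)) : Fin n → Bool := fun x => S x || decide (x ∈ β)

theorem mem_treeSet {S : Fin n → Bool} {x : Fin n} : x ∈ treeSet S ↔ S x = true := by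
  simp [treeSet]

theorem notMem_treeSet {S : Fin n → Bool} {x : Fin n} : x ∉ treeSet S ↔ S x = false := by
  simp [treeSet]

theorem treeSet_addList (S : Fin n → Bool) (β : List (Fin n)) :
    treeSet (addList S β) = treeSet S ∪ β.toFinset := by
  ext x
  simp [treeSet, addList]

theorem addPath_mono (next : Parents n) (f : ℕ) (u : Fin n) (S : Fin n → Bool) (x : Fin n)
    (hx : S x = true) : (addPath next f u S).val x = true := by
  induction f generalizing u S with
  | zero => exact hx
  | succ f ih =>
    simp only [addPath, Timed.bind_val]
    split_ifs
    · exact hx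
    · rcases next u with _ | y
      · exact hx
      · refine ih y _ ?_
        by_cases hxu : x = u
        · simp [hxu]
        · simpa [Function.update_of_ne hxu] using hx

theorem addPath_eq (next : Parents n) {u : Fin n} (γ : List (Fin n)) (S : Fin n → Bool) (f : ℕ)
    (w : Fin n) (hchain : (γ ++ [u]).IsChain fun a b => next a = some b) (hnd : γ.Nodup)
    (hγ : ∀ a ∈ γ, S a = false) (hu : S u = true) (hw : (γ ++ [u]).head? = some w)
    (hf : γ.length < f) : addPath next f w S = ⟨addList S γ, γ.length + 1⟩ := by
  induction γ generalizing S f w with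
  | nil =>
    obtain ⟨f, rfl⟩ := Nat.exists_eq_add_of_lt hf
    simp only [List.nil_append, List.head?_cons, Option.some.injEq] at hw
    subst hw
    have hset : addList S [] = S := by
      funext y
      simp [addList]
    rw [List.length_nil, zero_add, addPath, if_pos hu, hset]
    rfl
  | cons g γ ih =>
    obtain ⟨f, rfl⟩ := Nat.exists_eq_add_of_lt hf
    simp only [List.cons_append, List.head?_cons, Option.some.injEq] at hw
    subst hw
    rw [List.cons_append, List.isChain_cons] at hchain
    rw [List.nodup_cons] at hnd
    have hgu : ¬ u = g := fun h => by
      have := hγ g (by simp)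
      rw [← h, hu] at this
      cases this
    obtain ⟨x, hx⟩ : ∃ x, (γ ++ [u]).head? = some x := by
      cases γ <;> simp
    have hgx : next g = some x := hchain.1 x hx
    rw [addPath, if_neg (by simp [hγ g (by simp)]), hgx]
    have ih' := ih (Function.update S g true) ((g :: γ).length + f) x hchain.2 hnd.2
      (fun a ha => by
        rw [Function.update_of_ne (fun h => hnd.1 (h ▸ ha) : a ≠ g)]
        exact hγ a (by simp [ha]))
      (by rw [Function.update_of_ne hgu]; exact hu) hx
      (by simp only [List.length_cons]; omega)
    simp only [ih']
    have hset : addList (Function.update S g true) γ = addList S (g :: γ) := by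
      funext y
      by_cases hy : y = g <;> simp [addList, hy]
    rw [hset, List.length_cons, add_comm (γ.length + 1) 1]
    rfl

variable {G : SimpleGraph (Fin n)}

/-- The walk started at `v` is at `u`, it has not met the tree `S` before, and its current loop
erasure, as recorded by `next`, consists of `β`, in reverse order, and `u`. -/
structure LoopErased (G : SimpleGraph (Fin n)) (S : Fin n → Bool) (v : Fin n) (next : Parents n)
    (β : List (Fin n)) (u : Fin n) : Prop where
  chain : (u :: β).IsChain fun a b => next b = some a ∧ G.Adj b a
  nodup : (u :: β).Nodup
  notMem : ∀ a ∈ β, S a = false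
  start : (u :: β).getLast? = some v

theorem LoopErased.nil (S : Fin n → Bool) (v : Fin n) (next : Parents n) :
    LoopErased G S v next [] v :=
  ⟨List.isChain_singleton v, List.nodup_singleton v, by simp, rfl⟩

theorem LoopErased.length_lt {S : Fin n → Bool} {v : Fin n} {next : Parents n}
    {β : List (Fin n)} {u : Fin n} (h : LoopErased G S v next β u) : β.length < n := by
  have := h.nodup.length_le_card
  rw [Fintype.card_fin, List.length_cons] at this
  exact this

/-- Following the last exits from `v` traverses `β` backwards. The path has no repetitions, so the
bound `n` is not reached; the additional unit is the test that ends the loop. -/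
theorem LoopErased.addPath_eq {S : Fin n → Bool} {v : Fin n} {next : Parents n}
    {β : List (Fin n)} {u : Fin n} (h : LoopErased G S v next β u) (hu : S u = true) :
    addPath next n v S = ⟨addList S β, β.length + 1⟩ := by
  have hrev : β.reverse ++ [u] = (u :: β).reverse := by simp
  have := KemenyTTF.addPath_eq next β.reverse S n v
    (by
      rw [hrev, List.isChain_reverse]
      exact h.chain.imp fun a b hab => hab.1)
    (List.nodup_reverse.2 (List.nodup_cons.1 h.nodup).2)
    (fun a ha => h.notMem a (List.mem_reverse.1 ha)) hu
    (by rw [hrev, List.head?_reverse, h.start]) (by rw [List.length_reverse]; exact h.length_lt)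
  rw [this, List.length_reverse]
  congr 1
  funext x
  simp [addList]

/-- If `y` lies on the path, the path is cut back to `y`, which `remainingSteps_append` permits;
otherwise it is extended by `y`. -/
theorem LoopErased.step [DecidableRel G.Adj] (hP : IsChain (transitionMatrix G))
    {S : Fin n → Bool} {v : Fin n} {next : Parents n}
    {β : List (Fin n)} {u y : Fin n} (h : LoopErased G S v next β u) (hu : S u = false)
    (hy : G.Adj u y) :
    ∃ β', LoopErased G S v (Function.update next u (some y)) β' y ∧
      remainingSteps (transitionMatrix G) (treeSet S) (u :: β) y =
        remainingSteps (transitionMatrix G) (treeSet S) β' y := by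
  have huβ := (List.nodup_cons.1 h.nodup).1
  have hchain : (u :: β).IsChain fun a b =>
      Function.update next u (some y) b = some a ∧ G.Adj b a :=
    -- The chain condition reads `next` only at vertices of `β`, and `u` is not among them.
    h.chain.imp_of_mem_tail_imp fun a b _ hb hab => by
      rw [Function.update_of_ne (fun hbu => huβ (hbu ▸ hb) : b ≠ u)]
      exact hab
  have hmem : ∀ a ∈ u :: β, S a = false := by
    intro a ha
    rcases List.mem_cons.1 ha with rfl | ha
    · exact hu
    · exact h.notMem a ha
  by_cases hyβ : y ∈ u :: β
  · obtain ⟨pre, β', hsplit⟩ := List.append_of_mem hyβ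
    have hnd := h.nodup
    have hstart := h.start
    rw [hsplit] at hchain hnd hstart hmem ⊢
    refine ⟨β', ⟨hchain.right_of_append, (List.nodup_append.1 hnd).2.1,
      fun a ha => hmem a (by simp [ha]), ?_⟩, ?_⟩
    · rw [List.getLast?_append] at hstart
      rw [← hstart, List.getLast?_cons]
      rfl
    · exact remainingSteps_append hP pre β' hnd (notMem_treeSet.2 (hmem y (by simp)))
  · refine ⟨u :: β, ⟨List.isChain_cons_cons.2 ⟨⟨by simp, hy⟩, hchain⟩,
      List.nodup_cons.2 ⟨hyβ, h.nodup⟩, hmem, ?_⟩, rfl⟩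
    rw [List.getLast?_cons_cons]
    exact h.start

end LoopErased

/-! ### The Laplacian minor -/

section Minor

variable {n : ℕ} {G : SimpleGraph (Fin n)} [DecidableRel G.Adj]

theorem isChain_transitionMatrix (hn : 2 ≤ n) (hG : G.Connected) :
    IsChain (transitionMatrix G) := by
  have hd := degree_ne_zero hn hG
  refine ⟨transitionMatrix_nonneg hd, sum_transitionMatrix hd, fun u v => ?_⟩
  have := (SimpleGraph.reachable_iff_reflTransGen u v).1 (hG.preconnected u v)
  exact Relation.ReflTransGen.mono (fun a b hab => transitionMatrix_pos hd hab) u v this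

/-- Deleting `r` loses nothing: off `r`, the columns of the Green function killed at `r` vanish in
row `r`. -/
theorem laplacianMinor_mul_green (hP : IsChain (transitionMatrix G)) (r : Fin n) :
    laplacianMinor G r *
      (green (transitionMatrix G) {r}).submatrix Subtype.val Subtype.val = 1 := by
  ext u z
  have hu : (u : Fin n) ∉ ({r} : Finset (Fin n)) := by simpa using u.2
  have hr : green (transitionMatrix G) {r} r z = 0 := by
    rw [hP.green_of_mem (by simp), if_neg (Ne.symm z.2)]
  have h1 := hP.green_of_notMem (Finset.singleton_nonempty r) hu z
  rw [← Finset.add_sum_erase _ _ (Finset.mem_univ r), hr, mul_zero, zero_add] at h1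
  have h2 : ∑ y : {v : Fin n // v ≠ r}, transitionMatrix G u y *
      green (transitionMatrix G) {r} y z = ∑ y ∈ Finset.univ.erase r,
        transitionMatrix G u y * green (transitionMatrix G) {r} y z :=
    (Finset.sum_subtype (p := fun v => v ≠ r) (Finset.univ.erase r) (fun x => by simp)
      fun y => transitionMatrix G u y * green (transitionMatrix G) {r} y z).symm
  rw [laplacianMinor, sub_mul, one_mul, Matrix.sub_apply, Matrix.mul_apply]
  simp only [Matrix.submatrix_apply]
  rw [h2, h1, Matrix.one_apply, add_sub_cancel_right]
  simp only [Subtype.ext_iff]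

theorem isUnit_laplacianMinor (hP : IsChain (transitionMatrix G)) (r : Fin n) :
    IsUnit (laplacianMinor G r) :=
  IsUnit.of_mul_eq_one _ (laplacianMinor_mul_green hP r)

theorem trace_inv_laplacianMinor (hP : IsChain (transitionMatrix G)) (r : Fin n) :
    (laplacianMinor G r)⁻¹.trace = greenTrace (transitionMatrix G) {r} := by
  rw [Matrix.inv_eq_right_inv (laplacianMinor_mul_green hP r), greenTrace, Matrix.trace]
  exact (Finset.sum_subtype (p := fun v => v ≠ r) _ (fun x => by simp)
    fun x => green (transitionMatrix G) {r} x x).symm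

/-- Each diagonal entry counts the visit at time zero. This bound lets the trace absorb every cost
linear in `n`. -/
theorem card_sub_one_le_trace (hP : IsChain (transitionMatrix G)) (r : Fin n) :
    (n : ℝ) - 1 ≤ (laplacianMinor G r)⁻¹.trace := by
  rw [trace_inv_laplacianMinor hP, greenTrace]
  have h : ∑ x ∈ ({r} : Finset (Fin n))ᶜ, (1 : ℝ) ≤
      ∑ x ∈ ({r} : Finset (Fin n))ᶜ, green (transitionMatrix G) {r} x x :=
    Finset.sum_le_sum fun x _ => hP.one_le_green_self (Finset.singleton_nonempty r) x
  rw [Finset.sum_const, Finset.card_compl, Finset.card_singleton, Fintype.card_fin, nsmul_one,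
    Nat.cast_sub (Fin.pos r)] at h
  simpa using h

end Minor

/-! ### The expected cost of Wilson's algorithm -/

theorem sum_range_delayed_bind_le {α β : Type} (k : ℕ) (μ : PMF α) (f : α → Prog β) (N : ℕ) :
    ∑ t ∈ Finset.range N, (delayed k μ >>= f) t none ≤
      k + ∑' a, μ a * ∑ t ∈ Finset.range (N - k), f a t none := by
  have h0 : ∀ t, (delayed k μ >>= f) t none ≤ 1 := fun t => PMF.coe_le_one _ _
  rcases le_total N k with hN | hN
  · calc ∑ t ∈ Finset.range N, (delayed k μ >>= f) t none ≤ ∑ t ∈ Finset.range N, 1 :=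
          Finset.sum_le_sum fun t _ => h0 t
      _ = (N : ℝ≥0∞) := by simp
      _ ≤ k := by exact_mod_cast hN
      _ ≤ _ := le_self_add
  · obtain ⟨M, rfl⟩ := Nat.exists_eq_add_of_le hN
    rw [Finset.sum_range_add, Nat.add_sub_cancel_left]
    refine add_le_add ?_ (le_of_eq ?_)
    · refine (Finset.sum_le_sum fun t _ => h0 t).trans ?_
      simp
    · simp only [delayed_bind, Nat.le_add_right, if_true, Nat.add_sub_cancel_left,
        PMF.bind_apply, Finset.mul_sum]
      rw [Summable.tsum_finsetSum fun _ _ => ENNReal.summable]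

section Wilson

variable {n : ℕ} {G : SimpleGraph (Fin n)}

/-- The main loop of Wilson's algorithm. -/
noncomputable def wilsonFold (w : CostModel) (A : AdjLists G) (l : List (Fin n))
    (s : (Fin n → Bool) × Parents n) : Prog ((Fin n → Bool) × Parents n) :=
  l.foldlM (fun (s : (Fin n → Bool) × Parents n) v => do
      let next ← walk w A s.1 v s.2
      let inTree ← runTimed w (addPath next n v s.1)
      return (inTree, next)) s

/-- What is done in the main loop of Wilson's algorithm after a walk from `v` has ended. -/
noncomputable def wilsonRest (w : CostModel) (A : AdjLists G) (l : List (Fin n))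
    (S : Fin n → Bool) (v : Fin n) (next : Parents n) : Prog ((Fin n → Bool) × Parents n) :=
  runTimed w (addPath next n v S) >>= fun S' => wilsonFold w A l (S', next)

theorem wilsonFold_cons (w : CostModel) (A : AdjLists G) (v : Fin n) (l : List (Fin n))
    (s : (Fin n → Bool) × Parents n) :
    wilsonFold w A (v :: l) s = walk w A s.1 v s.2 >>= wilsonRest w A l s.1 v := by
  simp only [wilsonFold, List.foldlM_cons, Prog.bind_assoc, Prog.pure_bind]
  rfl

theorem wilson_eq (w : CostModel) (A : AdjLists G) (r : Fin n) :
    wilson w A r = runTimed w (tick (2 * n)) >>= fun _ => wilsonFold w A (List.finRange n)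
      (Function.update (fun _ => false) r true, fun _ => none) >>= fun s => pure s.2 := rfl

theorem expectedCost_wilsonRest (w : CostModel) (A : AdjLists G) (l : List (Fin n))
    (S : Fin n → Bool) (v : Fin n) (next : Parents n) :
    expectedCost (wilsonRest w A l S v next) = (w.basic * (addPath next n v S).time : ℕ) +
      expectedCost (wilsonFold w A l ((addPath next n v S).val, next)) :=
  expectedCost_runTimed_bind _ _ _

variable [DecidableRel G.Adj] (A : AdjLists G) {w : CostModel} (hdraw : 1 ≤ w.draw)
  (hd : ∀ u, G.degree u ≠ 0) (S : Fin n → Bool)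

include hdraw hd in
theorem walk_bind_eq {β : Type} (k : Parents n → Prog β) (u : Fin n) (next : Parents n) :
    walk w A S u next >>= k = runTimed w tick >>= fun _ =>
      if S u then k next
      else randomNeighbor w A u >>= fun x =>
        walk w A S x (Function.update next u (some x)) >>= k := by
  rw [walk_eq A hdraw hd, Prog.bind_assoc]
  congr 1
  funext _
  split_ifs
  · exact Prog.pure_bind _ _
  · exact Prog.bind_assoc _ _ _

include hdraw hd in
theorem expectedCost_walk_bind_of_mem {β : Type} (k : Parents n → Prog β) {u : Fin n}
    (hu : S u = true) (next : Parents n) :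
    expectedCost (walk w A S u next >>= k) = w.basic + expectedCost (k next) := by
  rw [walk_bind_eq A hdraw hd, expectedCost_runTimed_bind, if_pos hu]
  simp

include hdraw hd in
theorem expectedCost_walk_bind_of_notMem {β : Type} (k : Parents n → Prog β) {u : Fin n}
    (hu : S u = false) (next : Parents n) :
    expectedCost (walk w A S u next >>= k) = w.basic + (w.draw +
      ∑ x, ENNReal.ofReal (transitionMatrix G u x) *
        expectedCost (walk w A S x (Function.update next u (some x)) >>= k)) := by
  rw [walk_bind_eq A hdraw hd, expectedCost_runTimed_bind, if_neg (by simp [hu]),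
    expectedCost_randomNeighbor_bind A hd]
  simp

theorem sum_ofReal_transitionMatrix (u : Fin n) (hd : ∀ u, G.degree u ≠ 0) :
    ∑ x, ENNReal.ofReal (transitionMatrix G u x) = 1 := by
  rw [← ENNReal.ofReal_sum_of_nonneg fun x _ => transitionMatrix_nonneg hd u x,
    sum_transitionMatrix hd, ENNReal.ofReal_one]

include hdraw hd in
-- The recursion for the full expectation would also be satisfied by `∞`, so truncated tail sums are
-- bounded, by induction on the truncation. It decreases at each step because a draw costs at least
-- one unit, and the hitting time pays for each step.
theorem sum_range_walk_bind_le (hP : IsChain (transitionMatrix G))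
    (hS : (treeSet S).Nonempty) {β : Type} (k : Parents n → Prog β) (K : ℝ≥0∞)
    (hK : ∀ next, expectedCost (k next) ≤ K) (N : ℕ) (u : Fin n) (next : Parents n) :
    ∑ t ∈ Finset.range N, (walk w A S u next >>= k) t none ≤
      (w.basic + w.draw : ℕ) * ENNReal.ofReal (hitTime (transitionMatrix G) (treeSet S) u) +
        (w.basic + K) := by
  induction N using Nat.strong_induction_on generalizing u next with
  | _ N ih =>
    rcases Nat.eq_zero_or_pos N with rfl | hN
    · simp
    rw [walk_bind_eq A hdraw hd, runTimed_eq_delayed]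
    refine (sum_range_delayed_bind_le _ _ _ _).trans ?_
    rw [tsum_fintype, Fintype.sum_unique]
    have h1 : (PMF.pure (tick : Timed Unit).val : PMF Unit) default = 1 := by
      simp
    rw [h1, one_mul, tick_time, mul_one]
    cases hu : S u
    · have hpay := hP.hitTime_of_notMem hS (notMem_treeSet.2 hu)
      rw [if_neg (by simp), randomNeighbor_eq_delayed A w u (nbrs_toFinset_nonempty A hd u)]
      refine (add_le_add_right (sum_range_delayed_bind_le _ _ _ _) _).trans ?_
      rw [tsum_fintype]
      simp only [uniformOfFinset_nbrs_apply A hd]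
      set c : ℝ≥0∞ := ((w.basic + w.draw : ℕ) : ℝ≥0∞) with hc
      calc (w.basic : ℝ≥0∞) + (w.draw + ∑ x, ENNReal.ofReal (transitionMatrix G u x) *
            ∑ t ∈ Finset.range (N - w.basic - w.draw),
              (walk w A S x (Function.update next u (some x)) >>= k) t none)
          ≤ w.basic + (w.draw + ∑ x, ENNReal.ofReal (transitionMatrix G u x) *
            (c * ENNReal.ofReal (hitTime (transitionMatrix G) (treeSet S) x) +
              (w.basic + K))) := by
            gcongr with x
            exact ih _ (by omega) x _
        _ = c + (c * ENNReal.ofReal (∑ x, transitionMatrix G u x *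
            hitTime (transitionMatrix G) (treeSet S) x) + (w.basic + K)) := by
            rw [ENNReal.ofReal_sum_of_nonneg fun x _ =>
              mul_nonneg (hP.nonneg u x) (hP.hitTime_nonneg hS x)]
            simp only [ENNReal.ofReal_mul (hP.nonneg u _), mul_add (ENNReal.ofReal _),
              Finset.sum_add_distrib, ← Finset.sum_mul, sum_ofReal_transitionMatrix u hd,
              one_mul, Finset.mul_sum]
            rw [hc, Nat.cast_add, add_assoc]
            congr 3
            exact Finset.sum_congr rfl fun x _ => mul_left_comm _ _ _
        _ = _ := by
            rw [hpay, ENNReal.ofReal_add zero_le_one (Finset.sum_nonneg fun x _ =>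
              mul_nonneg (hP.nonneg u x) (hP.hitTime_nonneg hS x)), ENNReal.ofReal_one,
              mul_add, mul_one, add_assoc]
    · rw [if_pos rfl]
      calc (w.basic : ℝ≥0∞) + ∑ t ∈ Finset.range (N - w.basic), k next t none
          ≤ w.basic + K := by
            gcongr
            exact (ENNReal.sum_le_tsum _).trans (hK next)
        _ ≤ _ := le_add_self

include hdraw hd in
theorem expectedCost_walk_bind_ne_top (hP : IsChain (transitionMatrix G))
    (hS : (treeSet S).Nonempty) {β : Type} (k : Parents n → Prog β)
    (hk : ∀ next, expectedCost (k next) ≠ ∞) (u : Fin n) (next : Parents n) :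
    expectedCost (walk w A S u next >>= k) ≠ ∞ := by
  have h := sum_range_walk_bind_le A hdraw hd S hP hS k (∑ next, expectedCost (k next))
    (fun next => Finset.single_le_sum (f := fun next => expectedCost (k next))
      (fun _ _ => zero_le) (Finset.mem_univ next))
  rw [expectedCost, ENNReal.tsum_eq_iSup_nat]
  refine ne_top_of_le_ne_top ?_ (iSup_le fun N => h N u next)
  have hsum : ∑ next, expectedCost (k next) ≠ ∞ := ENNReal.sum_ne_top.2 fun next _ => hk next
  exact ENNReal.add_ne_top.2 ⟨ENNReal.mul_ne_top (ENNReal.natCast_ne_top _) ENNReal.ofReal_ne_top,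
    ENNReal.add_ne_top.2 ⟨ENNReal.natCast_ne_top _, hsum⟩⟩

include hdraw hd in
theorem expectedCost_wilsonFold_ne_top (hP : IsChain (transitionMatrix G)) {r : Fin n}
    (l : List (Fin n)) (S : Fin n → Bool) (hr : S r = true) (next : Parents n) :
    expectedCost (wilsonFold w A l (S, next)) ≠ ∞ := by
  induction l generalizing S next with
  | nil =>
    have : expectedCost (wilsonFold w A [] (S, next)) = 0 := expectedCost_pure _
    rw [this]
    exact ENNReal.zero_ne_top
  | cons v l ih =>
    rw [wilsonFold_cons]
    refine expectedCost_walk_bind_ne_top A hdraw hd S hP ⟨r, mem_treeSet.2 hr⟩ _ (fun next' => ?_)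
      v next
    rw [expectedCost_wilsonRest]
    exact ENNReal.add_ne_top.2 ⟨ENNReal.natCast_ne_top _,
      ih _ (addPath_mono next' n v S r hr) next'⟩

/-- The state of a walk in Wilson's algorithm: the current vertex, the array of last exits and the
current loop-erased path. -/
abbrev WalkState (G : SimpleGraph (Fin n)) (S : Fin n → Bool) (v : Fin n) : Type :=
  {p : Fin n × Parents n × List (Fin n) // LoopErased G S v p.2.1 p.2.2 p.1}

/-- Finiteness makes the error function in `expectedCost_wilsonFold` bounded. It holds because
loop-erased paths have no repeated vertices. -/
instance (S : Fin n → Bool) (v : Fin n) : Finite (WalkState G S v) := by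
  refine Finite.of_injective (β := Fin n × Parents n × {l : List (Fin n) // l.Nodup})
    (fun s => (s.1.1, s.1.2.1, ⟨s.1.2.2, (List.nodup_cons.1 s.2.nodup).2⟩)) ?_
  rintro ⟨⟨u, next, β⟩, h⟩ ⟨⟨u', next', β'⟩, h'⟩ heq
  simp only [Prod.mk.injEq, Subtype.mk.injEq] at heq ⊢
  exact heq

include hdraw hd in
-- Each start vertex pays for two final tests (of the walk and of `addPath`), each vertex added to
-- the tree for one round of `addPath`, and each walk step for a test and a draw. The hypothesis
-- `hl` makes the tree exhaust all vertices at the end, where the trace is empty.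
theorem expectedCost_wilsonFold (hP : IsChain (transitionMatrix G)) {r : Fin n}
    (l : List (Fin n)) (S : Fin n → Bool) (hr : S r = true) (hl : ∀ v, S v = false → v ∈ l)
    (next : Parents n) :
    expectedCost (wilsonFold w A l (S, next)) =
      ENNReal.ofReal (w.basic * (2 * l.length + (treeSet S)ᶜ.card) +
        (w.basic + w.draw) * greenTrace (transitionMatrix G) (treeSet S)) := by
  induction l generalizing S next with
  | nil =>
    have h1 : expectedCost (wilsonFold w A [] (S, next)) = 0 := expectedCost_pure _
    have h2 : (treeSet S)ᶜ = ∅ := by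
      refine Finset.compl_eq_empty_iff _ |>.2 (Finset.eq_univ_iff_forall.2 fun x => ?_)
      by_contra hx
      simpa using hl x (notMem_treeSet.1 hx)
    rw [h1, greenTrace, h2]
    simp
  | cons v l ih =>
    have hS : (treeSet S).Nonempty := ⟨r, mem_treeSet.2 hr⟩
    set P := transitionMatrix G with hPdef
    set k := wilsonRest w A l S v with hk
    have hfin : ∀ u next, expectedCost (walk w A S u next >>= k) ≠ ∞ :=
      expectedCost_walk_bind_ne_top A hdraw hd S hP hS k fun next' => by
        rw [hk, expectedCost_wilsonRest]
        exact ENNReal.add_ne_top.2 ⟨ENNReal.natCast_ne_top _,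
          expectedCost_wilsonFold_ne_top A hdraw hd hP l _ (addPath_mono next' n v S r hr) next'⟩
    set c : ℝ := w.basic * (2 * (v :: l).length + (treeSet S)ᶜ.card) with hc
    set e : ℝ := w.basic + w.draw with he
    let f : WalkState G S v → ℝ := fun s =>
      (expectedCost (walk w A S s.1.1 s.1.2.1 >>= k)).toReal -
        (c + e * remainingSteps P (treeSet S) s.1.2.2 s.1.1)
    have hmem : ∀ s : WalkState G S v, s.1.1 ∈ treeSet S → f s = 0 := by
      rintro ⟨⟨u, next', β⟩, h⟩ hu
      have hu' := mem_treeSet.1 hu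
      have hβ : ∀ a ∈ β, a ∉ treeSet S := fun a ha => notMem_treeSet.2 (h.notMem a ha)
      have hl' : ∀ v', addList S β v' = false → v' ∈ l := by
        intro v' hv'
        simp only [addList, Bool.or_eq_false_iff, decide_eq_false_iff_not] at hv'
        rcases List.mem_cons.1 (hl v' hv'.1) with rfl | hm
        · rcases List.mem_cons.1 (List.mem_of_getLast? h.start) with rfl | hm
          · simp [hu'] at hv'
          · exact absurd hm hv'.2
        · exact hm
      have hcard : ((treeSet S)ᶜ.card : ℝ) = (treeSet (addList S β))ᶜ.card + β.length := by
        rw [treeSet_addList, ← List.toFinset_card_of_nodup (List.nodup_cons.1 h.nodup).2]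
        rw [Finset.compl_union, ← Finset.sdiff_eq_inter_compl]
        have hsub : β.toFinset ⊆ (treeSet S)ᶜ := fun a ha =>
          Finset.mem_compl.2 (hβ a (List.mem_toFinset.1 ha))
        exact_mod_cast (Finset.card_sdiff_add_card_eq_card hsub).symm
      have hnn := hP.greenTrace_nonneg
        (hS.mono (Finset.subset_union_left (s₂ := β.toFinset)))
      simp only [f]
      rw [expectedCost_walk_bind_of_mem A hdraw hd S k hu', hk, expectedCost_wilsonRest,
        h.addPath_eq hu', ih (addList S β) (by simp [addList, hr]) hl' next', treeSet_addList,
        remainingSteps_of_mem hP hβ hu, hc, hcard, treeSet_addList]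
      rw [ENNReal.toReal_add (ENNReal.natCast_ne_top _)
          (ENNReal.add_ne_top.2 ⟨ENNReal.natCast_ne_top _, ENNReal.ofReal_ne_top⟩),
        ENNReal.toReal_add (ENNReal.natCast_ne_top _) ENNReal.ofReal_ne_top,
        ENNReal.toReal_ofReal (by positivity), ENNReal.toReal_natCast, ENNReal.toReal_natCast]
      push_cast [List.length_cons]
      ring
    have hstep : ∀ s : WalkState G S v, s.1.1 ∉ treeSet S → ∃ g : Fin n → ℝ,
        f s = ∑ y, P s.1.1 y * g y ∧
          ∀ y, P s.1.1 y ≠ 0 → ∃ s' : WalkState G S v, s'.1.1 = y ∧ g y = f s' := by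
      rintro ⟨⟨u, next', β⟩, h⟩ hu
      have hu' := notMem_treeSet.1 hu
      -- The recursion is stated for the uncut path `u :: β`; passing to the genuine next state,
      -- with its loop erased, does not change the value.
      refine ⟨fun y =>
        (expectedCost (walk w A S y (Function.update next' u (some y)) >>= k)).toReal -
          (c + e * remainingSteps P (treeSet S) (u :: β) y), ?_, fun y hy => ?_⟩
      · simp only [f]
        rw [expectedCost_walk_bind_of_notMem A hdraw hd S k hu',
          remainingSteps_step hP hS hu (List.nodup_cons.1 h.nodup).1]
        have hfin' : ∀ y ∈ Finset.univ, ENNReal.ofReal (P u y) *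
            expectedCost (walk w A S y (Function.update next' u (some y)) >>= k) ≠ ∞ :=
          fun y _ => ENNReal.mul_ne_top ENNReal.ofReal_ne_top (hfin _ _)
        rw [ENNReal.toReal_add (ENNReal.natCast_ne_top _)
            (ENNReal.add_ne_top.2 ⟨ENNReal.natCast_ne_top _, ENNReal.sum_ne_top.2 hfin'⟩),
          ENNReal.toReal_add (ENNReal.natCast_ne_top _) (ENNReal.sum_ne_top.2 hfin'),
          ENNReal.toReal_sum hfin', ENNReal.toReal_natCast, ENNReal.toReal_natCast]
        simp only [ENNReal.toReal_mul, ENNReal.toReal_ofReal (hP.nonneg u _), mul_sub, mul_add,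
          Finset.sum_sub_distrib, Finset.sum_add_distrib, ← Finset.sum_mul, hP.sum_eq_one]
        rw [Finset.sum_congr rfl fun y _ => mul_left_comm (P u y) e _, ← Finset.mul_sum, he]
        ring
      · obtain ⟨β', h', hrem⟩ := h.step hP hu' (adj_of_transitionMatrix_ne_zero hd hy)
        refine ⟨⟨⟨y, Function.update next' u (some y), β'⟩, h'⟩, rfl, ?_⟩
        simp only [f]
        rw [hrem]
    obtain ⟨K, hK⟩ := (Set.finite_range fun s => |f s|).bddAbove
    have hzero := eq_zero_of_harmonic hP hS (fun s : WalkState G S v => s.1.1) f K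
      (fun s => hK ⟨s, rfl⟩) hmem hstep ⟨⟨v, next, []⟩, LoopErased.nil S v next⟩
    simp only [f, remainingSteps_nil hP hS] at hzero
    rw [wilsonFold_cons, ← ENNReal.ofReal_toReal (hfin v next)]
    congr 1
    linarith

include hdraw hd in
-- The term `5 * n - 1` consists of `2 * n` for initialization, `2 * n` for the final tests, and `n
-- - 1` for the vertices added.
theorem expectedCost_wilson (hP : IsChain (transitionMatrix G)) (r : Fin n) :
    expectedCost (wilson w A r) =
      ENNReal.ofReal (w.basic * (5 * n - 1) +
        (w.basic + w.draw) * (laplacianMinor G r)⁻¹.trace) := by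
  have hT : treeSet (Function.update (fun _ => false) r true) = {r} := by
    ext x
    by_cases hx : x = r <;> simp [mem_treeSet, hx]
  have hnn := hP.greenTrace_nonneg (Finset.singleton_nonempty r)
  have hn : (1 : ℝ) ≤ n := by exact_mod_cast Fin.pos r
  have hlaw : Lawful (wilsonFold w A (List.finRange n)
      (Function.update (fun _ => false) r true, fun _ => none)) := wilson_fold_lawful A hd hdraw _ _
  rw [wilson_eq, expectedCost_runTimed_bind, expectedCost_bind hlaw,
    expectedCost_wilsonFold A hdraw hd hP (r := r) _ _ (by simp) (by simp), hT,
    trace_inv_laplacianMinor hP]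
  simp only [expectedCost_pure, mul_zero, tsum_zero, add_zero, tick_time]
  rw [← ENNReal.ofReal_natCast, ← ENNReal.ofReal_add (by positivity) (by positivity)]
  congr 1
  rw [Finset.card_compl, Finset.card_singleton, Fintype.card_fin, List.length_finRange,
    Nat.cast_sub (Fin.pos r)]
  push_cast
  ring

end Wilson

/-! ### Wilson's algorithm returns a spanning tree -/

section SpanningTree

variable {n : ℕ} {G : SimpleGraph (Fin n)}

/-- The pointers `next` make `S` a tree with root `r` in `G`. -/
structure IsPartialTree (G : SimpleGraph (Fin n)) (r : Fin n) (S : Fin n → Bool)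
    (next : Parents n) : Prop where
  mem_root : S r = true
  root : next r = none
  parent : ∀ v, S v = true → v ≠ r → ∃ p, next v = some p ∧ S p = true ∧ G.Adj v p
  reaches : ∀ v, S v = true →
    ∃ k : ℕ, (fun o : Option (Fin n) => o.bind next)^[k] (some v) = some r

/-- A walk overwrites `next` only outside the tree, so the tree built so far survives it. -/
theorem IsPartialTree.congr {r : Fin n} {S : Fin n → Bool} {next next' : Parents n}
    (h : IsPartialTree G r S next) (heq : ∀ a, S a = true → next' a = next a) :
    IsPartialTree G r S next' := by
  refine ⟨h.mem_root, (heq r h.mem_root).trans h.root, fun v hv hvr => ?_, fun v hv => ?_⟩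
  · rw [heq v hv]
    exact h.parent v hv hvr
  · obtain ⟨k, hk⟩ := h.reaches v hv
    refine ⟨k, ?_⟩
    induction k generalizing v with
    | zero => exact hk
    | succ k ih =>
      rw [Function.iterate_succ_apply] at hk ⊢
      -- A chain of `k + 1` steps from the root has already ended in `none`, so this case is void.
      by_cases hvr : v = r
      · rw [hvr] at hk
        simp only [Option.bind_some, h.root] at hk
        rw [iterate_bind_none] at hk
        cases hk
      · obtain ⟨p, hp, hpS, -⟩ := h.parent v hv hvr
        simp only [Option.bind_some, hp] at hk
        simp only [Option.bind_some, heq v hv, hp]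
        exact ih p hpS hk

theorem IsPartialTree.cons {r : Fin n} {S : Fin n → Bool} {next : Parents n}
    (h : IsPartialTree G r S next) {u b : Fin n} (hu : S u = true) (hb : next b = some u)
    (hadj : G.Adj b u) : IsPartialTree G r (fun x => S x || decide (x = b)) next := by
  refine ⟨by simp [h.mem_root], h.root, fun v hv hvr => ?_, fun v hv => ?_⟩
  · simp only [Bool.or_eq_true, decide_eq_true_eq] at hv
    rcases hv with hv | rfl
    · obtain ⟨p, hp, hpS, hpadj⟩ := h.parent v hv hvr
      exact ⟨p, hp, by simp [hpS], hpadj⟩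
    · exact ⟨u, hb, by simp [hu], hadj⟩
  · simp only [Bool.or_eq_true, decide_eq_true_eq] at hv
    rcases hv with hv | rfl
    · exact h.reaches v hv
    · obtain ⟨k, hk⟩ := h.reaches u hu
      refine ⟨k + 1, ?_⟩
      rw [Function.iterate_succ_apply]
      simp only [Option.bind_some, hb]
      exact hk

theorem IsPartialTree.addList {r : Fin n} {next : Parents n} (β : List (Fin n))
    {S : Fin n → Bool} (h : IsPartialTree G r S next) {u : Fin n} (hu : S u = true)
    (hchain : (u :: β).IsChain fun a b => next b = some a ∧ G.Adj b a) :
    IsPartialTree G r (addList S β) next := by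
  induction β generalizing S u with
  | nil =>
    have : KemenyTTF.addList S [] = S := by funext x; simp [KemenyTTF.addList]
    rwa [this]
  | cons b β ih =>
    rw [List.isChain_cons_cons] at hchain
    have := ih (h.cons hu hchain.1.1 hchain.1.2) (u := b) (by simp) hchain.2
    convert this using 1
    funext x
    simp [KemenyTTF.addList, Bool.or_assoc]

variable [DecidableRel G.Adj] (A : AdjLists G) (w : CostModel) (hd : ∀ u, G.degree u ≠ 0)

include hd in
theorem ensures_walkRounds (hP : IsChain (transitionMatrix G)) (S : Fin n → Bool) (v : Fin n)
    (f : ℕ) (u : Fin n) (next next₀ : Parents n) (heq : ∀ a, S a = true → next a = next₀ a)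
    (β : List (Fin n)) (h : LoopErased G S v next β u) :
    Ensures (walkRounds w A S f u next) fun next' =>
      (∀ a, S a = true → next' a = next₀ a) ∧
        ∃ u β, S u = true ∧ LoopErased G S v next' β u := by
  induction f generalizing u next β with
  | zero => intro t a s hne; simp [walkRounds] at hne
  | succ f ih =>
    rw [walkRounds]
    refine Ensures.bind (Q := fun _ => True) (Ensures.runTimed _ _ trivial) fun _ _ => ?_
    split_ifs with hu
    · exact Ensures.pure ⟨heq, u, β, hu, h⟩
    · have hu' : S u = false := by simpa using hu
      refine Ensures.bind (ensures_randomNeighbor A hd w u) fun x hx => ?_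
      obtain ⟨β', h', -⟩ := h.step hP hu' hx
      refine ih x _ (fun a ha => ?_) β' h'
      rw [Function.update_of_ne (fun hau => hu (hau ▸ ha) : a ≠ u)]
      exact heq a ha

include hd in
theorem ensures_walk (hP : IsChain (transitionMatrix G)) (S : Fin n → Bool) (v : Fin n)
    (next : Parents n) :
    Ensures (walk w A S v next) fun next' => (∀ a, S a = true → next' a = next a) ∧
      ∃ u β, S u = true ∧ LoopErased G S v next' β u := fun t a s hne =>
  ensures_walkRounds A w hd hP S v (t + 2) v next next (fun _ _ => rfl) []
    (LoopErased.nil S v next) t a s hne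

include hd in
theorem ensures_wilsonFold (hP : IsChain (transitionMatrix G)) {r : Fin n} (l : List (Fin n))
    (S : Fin n → Bool) (next : Parents n) (h : IsPartialTree G r S next)
    (hl : ∀ v, S v = false → v ∈ l) :
    Ensures (wilsonFold w A l (S, next)) fun s => IsSpanningTree G r s.2 := by
  induction l generalizing S next with
  | nil =>
    have hall : ∀ v, S v = true := fun v => by
      by_contra hv
      simpa using hl v (by simpa using hv)
    refine Ensures.pure ⟨h.root, fun v hv => ?_, fun v => h.reaches v (hall v)⟩
    obtain ⟨p, hp, -, hadj⟩ := h.parent v (hall v) hv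
    exact ⟨p, hp, hadj⟩
  | cons v l ih =>
    rw [wilsonFold_cons]
    refine Ensures.bind (ensures_walk A w hd hP S v next) ?_
    rintro next' ⟨heq, u, β, hu, hle⟩
    refine Ensures.bind (Q := fun S' => S' = addList S β)
      (Ensures.runTimed _ _ (by rw [hle.addPath_eq hu])) ?_
    rintro _ rfl
    refine ih _ _ ((h.congr heq).addList β hu hle.chain) fun v' hv' => ?_
    simp only [addList, Bool.or_eq_false_iff, decide_eq_false_iff_not] at hv'
    rcases List.mem_cons.1 (hl v' hv'.1) with rfl | hm
    · rcases List.mem_cons.1 (List.mem_of_getLast? hle.start) with rfl | hm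
      · simp [hu] at hv'
      · exact absurd hm hv'.2
    · exact hm

include hd in
theorem ensures_wilson (hP : IsChain (transitionMatrix G)) (r : Fin n) :
    Ensures (wilson w A r) (IsSpanningTree G r) := by
  rw [wilson_eq]
  refine Ensures.bind (Q := fun _ => True) (Ensures.runTimed _ _ trivial) fun _ _ => ?_
  refine Ensures.bind (ensures_wilsonFold A w hd hP (r := r) _ _ _ ?_ (by simp))
    fun s hs => Ensures.pure hs
  have hSr : ∀ v, Function.update (fun _ => false) r true v = true → v = r := fun v hv => by
    by_contra hne
    simp [Function.update_of_ne hne] at hv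
  exact ⟨by simp, rfl, fun v hv hne => absurd (hSr v hv) hne, fun v hv => ⟨0, by rw [hSr v hv]; rfl⟩⟩

end SpanningTree

/-! ### The running time of the whole algorithm -/

section Total

variable {n : ℕ} {G : SimpleGraph (Fin n)} [DecidableRel G.Adj]

theorem one_le_trace (hn : 2 ≤ n) (hG : G.Connected) (r : Fin n) :
    1 ≤ (laplacianMinor G r)⁻¹.trace := by
  have h := card_sub_one_le_trace (isChain_transitionMatrix hn hG) r
  have hn' : (2 : ℝ) ≤ n := by exact_mod_cast hn
  linarith

theorem expectedCost_wilson_timeCost_le (hn : 2 ≤ n) (hG : G.Connected) (A : AdjLists G)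
    (r : Fin n) : expectedCost (wilson timeCost A r) ≤
      ENNReal.ofReal (11 * (laplacianMinor G r)⁻¹.trace) := by
  have hP := isChain_transitionMatrix hn hG
  rw [expectedCost_wilson A (w := timeCost) le_rfl (degree_ne_zero hn hG) hP]
  refine ENNReal.ofReal_le_ofReal ?_
  have h := card_sub_one_le_trace hP r
  have h1 := one_le_trace hn hG r
  simp only [timeCost, Nat.cast_one]
  -- With `T` for the trace, `n ≤ T + 1` and `T ≥ 1` give `5 * n - 1 + 2 * T ≤ 7 * T + 4 ≤ 11 * T`.
  linarith

theorem expectedCost_samplingLoop_le (hn : 2 ≤ n) (hG : G.Connected) (A : AdjLists G)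
    (r : Fin n) (ω : ℕ) (s : ℤ × (ℕ → ℤ)) :
    expectedCost (samplingLoop A r (preprocess A r).val ω s) ≤
      ENNReal.ofReal (42 * (ω * ((laplacianMinor G r)⁻¹.trace +
        n * min (G.diam : ℝ) (Real.log n)))) := by
  have hd := degree_ne_zero hn hG
  have hP := isChain_transitionMatrix hn hG
  have h1 := one_le_trace hn hG r
  set T := (laplacianMinor G r)⁻¹.trace with hT
  set M := (n : ℝ) * min (G.diam : ℝ) (Real.log n) with hM
  have hM0 : 0 ≤ M := mul_nonneg (Nat.cast_nonneg _)
    (le_min (Nat.cast_nonneg _) (by linarith [half_le_log hn]))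
  induction ω generalizing s with
  | zero =>
    have : expectedCost (samplingLoop A r (preprocess A r).val 0 s) = 0 := expectedCost_pure _
    rw [this]
    exact zero_le
  | succ ω ih =>
    rw [samplingLoop, expectedCost_runTimed_bind]
    have hrest : ∀ τ, out (wilson timeCost A r) τ ≠ 0 → expectedCost
        (runTimed timeCost (processSample A r (preprocess A r).val (preprocess A r).val.mode τ s)
          >>= fun s' => samplingLoop A r (preprocess A r).val ω s') ≤
        ENNReal.ofReal (42 * M) + ENNReal.ofReal (42 * (ω * (T + M))) := by
      intro τ hτ
      have hspan := (ensures_wilson A timeCost hd hP r).of_out hτ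
      rw [expectedCost_runTimed_bind]
      refine add_le_add ?_ (ih _)
      rw [← ENNReal.ofReal_natCast]
      refine ENNReal.ofReal_le_ofReal ?_
      rw [show timeCost.basic = 1 from rfl, one_mul]
      exact processSample_mode_time_le hn hG A hspan.1 s
    refine (add_le_add_right ((expectedCost_bind_le (wilson_lawful A hd le_rfl r) _ _
      hrest).trans (add_le_add_left (expectedCost_wilson_timeCost_le hn hG A r) _)) _).trans ?_
    rw [← ENNReal.ofReal_natCast, ← ENNReal.ofReal_add (by positivity) (by positivity),
      ← ENNReal.ofReal_add (by positivity) (by positivity),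
      ← ENNReal.ofReal_add (by positivity) (by positivity)]
    refine ENNReal.ofReal_le_ofReal ?_
    -- One sample costs at most `1 + 11 * T + 42 * M`, which is at most `42 * (T + M)` because `T ≥
    -- 1`.
    simp only [timeCost, tick_time]
    push_cast
    nlinarith

theorem expectedCost_ttf_le (hn : 2 ≤ n) (hG : G.Connected) (A : AdjLists G)
    (r : Fin n) (ω : ℕ) :
    expectedCost (ttf A r ω) ≤
      ENNReal.ofReal (42 * (G.edgeFinset.card + ω * ((laplacianMinor G r)⁻¹.trace +
        n * min (G.diam : ℝ) (Real.log n)))) := by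
  have hd := degree_ne_zero hn hG
  have h1 := one_le_trace hn hG r
  have hloop := expectedCost_samplingLoop_le hn hG A r ω (0, (preprocess A r).val.store)
  set T := (laplacianMinor G r)⁻¹.trace with hT
  set M := (n : ℝ) * min (G.diam : ℝ) (Real.log n) with hM
  have hM0 : 0 ≤ M := mul_nonneg (Nat.cast_nonneg _)
    (le_min (Nat.cast_nonneg _) (by linarith [half_le_log hn]))
  have hlaw : ∀ k s, Lawful (samplingLoop A r (preprocess A r).val k s) := by
    intro k
    induction k with
    | zero => exact fun s => Lawful.pure s
    | succ k ih =>
      exact fun s => Lawful.runTimed_bind _ _ fun _ => (wilson_lawful A hd le_rfl r).bind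
        fun _ => Lawful.runTimed_bind _ _ fun s' => ih s'
  rw [ttf, expectedCost_runTimed_bind]
  have hlast : ∀ s : ℤ × (ℕ → ℤ), out (samplingLoop A r (preprocess A r).val ω
      (0, (preprocess A r).val.store)) s ≠ 0 →
      expectedCost (runTimed timeCost tick >>= fun _ =>
        (pure ((s.1 : ℚ) / (((preprocess A r).val.twoM : ℚ) * ω)) : Prog ℚ)) ≤ 1 := by
    intro s _
    rw [expectedCost_runTimed_bind, expectedCost_pure]
    simp [timeCost]
  refine (add_le_add_right ((expectedCost_bind_le (hlaw _ _) _ _ hlast).trans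
    (add_le_add_left hloop _)) _).trans ?_
  have hm := preprocess_time_le hn hG A r
  have hnm := card_le_two_mul_card_edges hn hG
  have hm' : ((preprocess A r).time : ℝ) ≤ 30 * G.edgeFinset.card := by exact_mod_cast hm
  have hm1 : (1 : ℝ) ≤ G.edgeFinset.card := by
    exact_mod_cast (show 1 ≤ G.edgeFinset.card by omega)
  rw [← ENNReal.ofReal_natCast, ← ENNReal.ofReal_one,
    ← ENNReal.ofReal_add (by positivity) (by positivity),
    ← ENNReal.ofReal_add (by positivity) (by positivity)]
  refine ENNReal.ofReal_le_ofReal ?_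
  rw [show timeCost.basic = 1 from rfl, one_mul]
  -- Preprocessing and the final division cost at most `30 * m + 1`, and this is at most `42 * m`
  -- since `m ≥ 1`.
  linarith

end Total

end KemenyTTF

/-! ### The main theorem -/

theorem mainTheorem10 :
    ∃ C : ℝ, 0 < C ∧
      ∀ (n : ℕ), 2 ≤ n →
      ∀ (G : SimpleGraph (Fin n)) [DecidableRel G.Adj], G.Connected →
      ∀ (A : KemenyTTF.AdjLists G) (r : Fin n),
        -- `I - P_r` is invertible
        IsUnit (KemenyTTF.laplacianMinor G r) ∧
        -- Wilson's algorithm: expected number of random-walk steps, and expected running time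
        KemenyTTF.expectedCost (KemenyTTF.wilson KemenyTTF.walkCost A r) =
          ENNReal.ofReal (KemenyTTF.laplacianMinor G r)⁻¹.trace ∧
        KemenyTTF.expectedCost (KemenyTTF.wilson KemenyTTF.timeCost A r) ≤
          ENNReal.ofReal (C * (KemenyTTF.laplacianMinor G r)⁻¹.trace) ∧
        -- processing one sampled tree, with either implementation of `vol_sum`
        (∀ (τ : KemenyTTF.Parents n), KemenyTTF.IsSpanningTree G r τ → ∀ s : ℤ × (ℕ → ℤ),
          ((KemenyTTF.processSample A r (KemenyTTF.preprocess A r).val .bit τ s).time : ℝ) ≤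
            C * (n * Real.log n) ∧
          ((KemenyTTF.processSample A r (KemenyTTF.preprocess A r).val .path τ s).time : ℝ) ≤
            C * (n * G.diam)) ∧
        -- preprocessing
        ((KemenyTTF.preprocess A r).time : ℝ) ≤ C * G.edgeFinset.card ∧
        -- the sampling loop, and the whole algorithm
        ∀ ω : ℕ,
          (∀ s : ℤ × (ℕ → ℤ),
            KemenyTTF.expectedCost
                (KemenyTTF.samplingLoop A r (KemenyTTF.preprocess A r).val ω s) ≤
              ENNReal.ofReal (C * (ω * ((KemenyTTF.laplacianMinor G r)⁻¹.trace +
                n * min (G.diam : ℝ) (Real.log n))))) ∧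
          KemenyTTF.expectedCost (KemenyTTF.ttf A r ω) ≤
            ENNReal.ofReal (C * (G.edgeFinset.card +
              ω * ((KemenyTTF.laplacianMinor G r)⁻¹.trace +
                n * min (G.diam : ℝ) (Real.log n)))) := by
  -- The largest of the constants obtained is the one for processing a sample.
  refine ⟨42, by norm_num, fun n hn G _ hG A r => ?_⟩
  have hd := KemenyTTF.degree_ne_zero hn hG
  have hP := KemenyTTF.isChain_transitionMatrix hn hG
  have hT := KemenyTTF.one_le_trace hn hG r
  refine ⟨KemenyTTF.isUnit_laplacianMinor hP r, ?_, ?_, fun τ hτ s => ⟨?_, ?_⟩, ?_,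
    fun ω => ⟨fun s => KemenyTTF.expectedCost_samplingLoop_le hn hG A r ω s,
      KemenyTTF.expectedCost_ttf_le hn hG A r ω⟩⟩
  · rw [KemenyTTF.expectedCost_wilson A (w := KemenyTTF.walkCost) le_rfl hd hP]
    simp [KemenyTTF.walkCost]
  · exact (KemenyTTF.expectedCost_wilson_timeCost_le hn hG A r).trans
      (ENNReal.ofReal_le_ofReal (by linarith))
  · exact KemenyTTF.processSample_bit_time_le_log hn hG A hτ.1 s
  · refine (KemenyTTF.processSample_path_time_le_diam hn hG A hτ.1 s).trans ?_
    gcongr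
    norm_num
  · have h : ((KemenyTTF.preprocess A r).time : ℝ) ≤ 30 * G.edgeFinset.card := by
      exact_mod_cast KemenyTTF.preprocess_time_le hn hG A r
    refine h.trans ?_
    gcongr
    norm_num
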